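/- **Semi-infinite configurations.** The twisted square ladder is the graph with vertices $x_i,y_i$ ($i\in\mathbb Z$; $i$ is the column, $x$ = upper row, $y$ = lower row) and edges $x_iy_i$, $x_iy_{i+1}$, $x_{i+1}y_i$ for all $i$. A set $\Omega\subset\mathbb Z$ is a Dirac set if $\Omega_e=\Omega\cap\mathbb Z_{\ge0}$ and $\Omega_p=\mathbb Z_{<0}\setminus\Omega$ are finite; its charge is $C(\Omega)=|\Omega_e|-|\Omega_p|$ and its energy is $U(\Omega)=\sum_{\alpha\in\Omega_e\cup\Omega_p}|\alpha|$. A semi-infinite configuration with tail in a given row is an independent set of vertices whose set $\Omega$ of occupied columns is a Dirac set and such that all columns sufficiently far to the left are occupied in the given row; its charge and energy are those of $\Omega$. Let $F(t,q)=\sum t^{C}q^{U}$ be the statistical sum over all semi-infinite configurations with tail in a fixed row (as a formal series). **The module $\Upsilon$.** Let $\Lambda$ be the complex algebra of polynomials in anticommuting elements $x_i,y_i$, $i\in\mathbb Z$. For $N\in\mathbb Z$ let $\Upsilon(N)=\Lambda\circ\gamma_N$ be the $\Lambda$-module induced from a vector $\gamma_N$ with $$x_i\gamma_N=0\ (i>N-1),\qquad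 y_i\gamma_N=0\ (i>N),$$ and with the relations $\sum_{i}x_iy_{-i+s}=0$, $\sum_i(-1)^ix_iy_{-i+2s+1}=0$ for all $s\in\mathbb Z$ (on each vector only finitely many terms are non-zero). The maps $\Upsilon(N-1)\to\Upsilon(N)$, $\gamma_{N-1}\mapsto y_N\gamma_N$, are well defined; let $\Upsilon=\varinjlim\Upsilon(N)$. **Proposition.** The relations above hold on $\Upsilon$, and there are unique linear operators $c,u$ on $\Upsilon$ with $$[c,u]=0,\quad [c,x_i]=x_i,\ [c,y_i]=y_i,\quad [u,x_i]=-ix_i,\ [u,y_i]=-iy_i,$$ $$c\,\gamma_N=-N\gamma_N,\qquad u\,\gamma_N=\tfrac{N(N+1)}2\gamma_N\qquad(N\in\mathbb Z).$$ $\Upsilon$ is the direct sum of the joint eigenspaces of $(c,u)$ with integral eigenvalues, these are finite-dimensional, the number of configurations with tail in a fixed row and with given charge and energy is finite, and, as formal series, $$\mathrm{Tr}_\Upsilon(q^ut^c)=F(t,q),$$ for either choice of the row of the tail. Moreover, $\Upsilon$ has a basis indexed by the semi-infinite configurations with tail in the lower row. The basis vector of a configuration is the monomial $$x_{i_1}\cdots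 x_{i_l}\,y_{j_1}\cdots y_{j_m}\,\gamma_N,\qquad i_1<\dots<i_l,\quad j_1<\dots<j_m\le N,$$ where $\{i_a\}$ is the set of all $i$ such that the vertex $x_{-i}$ is occupied, $\{j_b\}$ is the set of all $j\le N$ such that the vertex $y_{-j}$ is occupied, and $N$ is any integer such that $y_{-j}$ is occupied for all $j>N$ (such $N$ exist, and the monomial, as a vector of $\Upsilon$, does not depend on $N$). This vector is an eigenvector of $c$ and $u$ whose eigenvalues are the charge and the energy of the configuration. -/

import Mathlib

noncomputable section

namespace SquareLadder

/-! ### The statistical model -/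

/-- The two rows of the ladder; a particle in column `i` of the upper (lower) row is denoted
by `x_i` (by `y_i`). -/
inductive Row : Type
  | upper : Row
  | lower : Row
  deriving DecidableEq

/-- The graph of the twisted square ladder, infinite in both directions: the vertices are the pairs
(column, row), and the edges join `x_i` with `y_i`, `x_i` with `y_{i+1}`, and `x_{i+1}` with `y_i`
for all integers `i`. -/
def twistedLadder : SimpleGraph (ℤ × Row) where
  Adj v w := v.2 ≠ w.2 ∧ |v.1 - w.1| ≤ 1
  symm := ⟨fun v w h => ⟨h.1.symm, by rw [abs_sub_comm]; exact h.2⟩⟩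
  loopless := ⟨fun _ h => h.1 rfl⟩

/-- `Ω ∩ ℤ_{≥ 0}`. -/
def diracE (Ω : Set ℤ) : Set ℤ := Ω ∩ {k | 0 ≤ k}

/-- `ℤ_{< 0} ∖ Ω`. -/
def diracP (Ω : Set ℤ) : Set ℤ := {k | k < 0} \ Ω

/-- Dirac sets of integers. -/
def IsDirac (Ω : Set ℤ) : Prop := (diracE Ω).Finite ∧ (diracP Ω).Finite

/-- The charge of a Dirac set. -/
def diracCharge (Ω : Set ℤ) : ℤ := ((diracE Ω).ncard : ℤ) - ((diracP Ω).ncard : ℤ)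

/-- The energy of a Dirac set. -/
def diracEnergy (Ω : Set ℤ) : ℤ := ∑ᶠ k ∈ diracE Ω ∪ diracP Ω, |k|

/-- Semi-infinite configurations whose tail lies in the row `r`: independent sets of vertices of the
twisted ladder whose set of occupied columns is a Dirac set and for which all columns sufficiently
far to the left are occupied in the row `r`. -/
structure Config (r : Row) where
  /-- the occupied vertices -/
  carrier : Set (ℤ × Row)
  indep : twistedLadder.IsIndepSet carrier
  dirac : IsDirac (Prod.fst '' carrier)
  tail : ∃ M : ℤ, ∀ k : ℤ, k ≤ M → (k, r) ∈ carrier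

/-- The charge `C` of a configuration. -/
def Config.charge {r : Row} (S : Config r) : ℤ := diracCharge (Prod.fst '' S.carrier)

/-- The energy `U` of a configuration. -/
def Config.energy {r : Row} (S : Config r) : ℤ := diracEnergy (Prod.fst '' S.carrier)

/-- The configurations of charge `n` and energy `m`. -/
def configsOf (r : Row) (n m : ℤ) : Set (Config r) := {S | S.charge = n ∧ S.energy = m}

/-- The statistical sum `F(t, q) = ∑ t ^ C q ^ U` over the configurations with tail in the row `r`,
as a formal series: `statSum r n m` is the coefficient of `t ^ n q ^ m`. (These sets of
configurations are finite, which is a part of the theorem below.) -/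
def statSum (r : Row) (n m : ℤ) : ℕ := (configsOf r n m).ncard

/-! ### The algebra of anticommuting elements `x_i`, `y_i` and the modules `Υ(N)` -/

/-- The complex algebra of polynomials in the anticommuting elements `x_i`, `y_i`, `i ∈ ℤ`. -/
abbrev Fermion : Type := ExteriorAlgebra ℂ ((ℤ × Row) →₀ ℂ)

/-- The generator `x_i`. -/
def x (i : ℤ) : Fermion := ExteriorAlgebra.ι ℂ (Finsupp.single (i, Row.upper) 1)

/-- The generator `y_i`. -/
def y (i : ℤ) : Fermion := ExteriorAlgebra.ι ℂ (Finsupp.single (i, Row.lower) 1)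

/-- The sum `∑ w_i x_i y_{s-i}` over those `i` for which both `i ≤ N - 1` and `s - i ≤ N`. All
other terms annihilate a vector that is annihilated by `x_i` for `i > N - 1` and by `y_i` for
`i > N`. -/
def relSum (N : ℤ) (w : ℤ → ℂ) (s : ℤ) : Fermion :=
  ∑ i ∈ Finset.Icc (s - N) (N - 1), w i • (x i * y (s - i))

/-- The left ideal of all elements that annihilate the extreme vector `γ_N`: it is generated by
`x_i` for `i > N - 1`, by `y_i` for `i > N`, and by the relations
`∑ x_i y_{s-i}` and `∑ (-1)^i x_i y_{2s+1-i}`, `s ∈ ℤ`. Products `x_i y_j` are central, so these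
relations then hold on every vector of the quotient. -/
def annihilator (N : ℤ) : Submodule Fermion Fermion :=
  Submodule.span Fermion
    ({a | ∃ i : ℤ, N - 1 < i ∧ a = x i} ∪ {a | ∃ i : ℤ, N < i ∧ a = y i} ∪
      {a | ∃ s : ℤ, a = relSum N (fun _ => 1) s} ∪
      {a | ∃ s : ℤ, a = relSum N (fun i => (-1 : ℂ) ^ i) (2 * s + 1)})

/-- The induced representation `Υ(N)`. -/
abbrev UpsilonN (N : ℤ) : Type := Fermion ⧸ annihilator N

/-- The extreme vector `γ_N` of `Υ(N)`. -/
def extremeN (N : ℤ) : UpsilonN N := (annihilator N).mkQ 1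

/-- The product `y_{N+1} y_{N+2} ⋯ y_{N+d}`. -/
def yProd (N : ℤ) : ℕ → Fermion
  | 0 => 1
  | d + 1 => yProd N d * y (N + d + 1)

lemma y_mul_x (i j : ℤ) : y i * x j = -(x j * y i) :=
  eq_neg_of_add_eq_zero_left (ExteriorAlgebra.ι_add_mul_swap _ _)

lemma y_mul_y (i j : ℤ) : y i * y j = -(y j * y i) :=
  eq_neg_of_add_eq_zero_left (ExteriorAlgebra.ι_add_mul_swap _ _)

lemma y_sq (i : ℤ) : y i * y i = 0 := ExteriorAlgebra.ι_sq_zero _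

lemma x_mem {N i : ℤ} (h : N - 1 < i) : x i ∈ annihilator N :=
  Submodule.subset_span (Or.inl (Or.inl (Or.inl ⟨i, h, rfl⟩)))

lemma y_mem {N i : ℤ} (h : N < i) : y i ∈ annihilator N :=
  Submodule.subset_span (Or.inl (Or.inl (Or.inr ⟨i, h, rfl⟩)))

lemma xy_mem_of_x {N i j : ℤ} (h : N - 1 < i) : x i * y j ∈ annihilator N := by
  have : x i * y j = (-y j) * x i := by rw [neg_mul, y_mul_x, neg_neg]
  rw [this]
  exact (annihilator N).smul_mem (-y j) (x_mem h)

lemma xy_mem_of_y {N i j : ℤ} (h : N < j) : x i * y j ∈ annihilator N :=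
  (annihilator N).smul_mem (x i) (y_mem h)

lemma smul_mem' {N : ℤ} (w : ℂ) {a : Fermion} (h : a ∈ annihilator N) : w • a ∈ annihilator N := by
  rw [Algebra.smul_def]; exact (annihilator N).smul_mem _ h

lemma relSum_mul_y {N : ℤ} (w : ℤ → ℂ) (s : ℤ) (h : relSum (N + 1) w s ∈ annihilator (N + 1)) :
    relSum N w s * y (N + 1) ∈ annihilator (N + 1) := by
  have key : ∀ i, (x i * y (s - i)) * y (N + 1) = y (N + 1) * (x i * y (s - i)) := by
    intro i
    rw [← mul_assoc, y_mul_x, neg_mul, mul_assoc, mul_assoc, y_mul_y (N + 1), mul_neg, neg_neg]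
  have hsub : Finset.Icc (s - N) (N - 1) ⊆ Finset.Icc (s - (N + 1)) (N + 1 - 1) :=
    Finset.Icc_subset_Icc (by omega) (by omega)
  have hdiff : relSum (N + 1) w s = relSum N w s +
      ∑ i ∈ Finset.Icc (s - (N + 1)) (N + 1 - 1) \ Finset.Icc (s - N) (N - 1),
        w i • (x i * y (s - i)) := by
    exact (Finset.sum_sdiff hsub).symm.trans (add_comm _ _)
  have e : relSum N w s * y (N + 1) = y (N + 1) * relSum N w s := by
    simp only [relSum, Finset.sum_mul, Finset.mul_sum, smul_mul_assoc, mul_smul_comm, key]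
  rw [e, eq_sub_of_add_eq hdiff.symm, mul_sub]
  refine Submodule.sub_mem _ ((annihilator (N + 1)).smul_mem _ h) ?_
  rw [Finset.mul_sum]
  refine Submodule.sum_mem _ fun i hi => ?_
  rw [mul_smul_comm]
  refine smul_mem' _ ?_
  rw [← key]
  simp only [Finset.mem_sdiff, Finset.mem_Icc] at hi
  by_cases hc : i = s - (N + 1)
  · have : s - i = N + 1 := by omega
    rw [this, mul_assoc, y_sq, mul_zero]
    exact Submodule.zero_mem _
  · have : i = N := by omega
    subst this
    rw [mul_assoc, y_mul_y, mul_neg, ← mul_assoc]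
    have h2 : x i * y (i + 1) ∈ annihilator (i + 1) := by
      have h3 : ∀ w : ℤ → ℂ, relSum (i + 1) w (2 * i + 1) = w i • (x i * y (i + 1)) := by
        intro w
        have e1 : 2 * i + 1 - (i + 1) = i := by ring
        have e2 : i + 1 - 1 = i := by ring
        have e3 : 2 * i + 1 - i = i + 1 := by ring
        rw [relSum, e1, e2, Finset.Icc_self, Finset.sum_singleton, e3]
      have h4 : relSum (i + 1) (fun _ => 1) (2 * i + 1) ∈ annihilator (i + 1) :=
        Submodule.subset_span (Or.inl (Or.inr ⟨_, rfl⟩))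
      rw [h3, one_smul] at h4
      exact h4
    have h5 : x i * y (i + 1) * y (s - i) = y (s - i) * (x i * y (i + 1)) := by
      rw [← mul_assoc, y_mul_x, neg_mul, mul_assoc, mul_assoc, y_mul_y (s - i), mul_neg, neg_neg]
    rw [h5]
    exact Submodule.neg_mem _ ((annihilator (i + 1)).smul_mem _ h2)

lemma annihilator_le_step (N : ℤ) :
    annihilator N ≤ (annihilator (N + 1)).comap (LinearMap.toSpanSingleton Fermion Fermion
      (y (N + 1))) := by
  rw [annihilator, Submodule.span_le]
  rintro a (((⟨i, hi, rfl⟩ | ⟨i, hi, rfl⟩) | ⟨s, rfl⟩) | ⟨s, rfl⟩)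
  · change x i * y (N + 1) ∈ annihilator (N + 1)
    by_cases h : N + 1 - 1 < i
    · exact xy_mem_of_x h
    · have : i = N := by omega
      subst this
      have h4 : relSum (i + 1) (fun _ => 1) (2 * i + 1) ∈ annihilator (i + 1) :=
        Submodule.subset_span (Or.inl (Or.inr ⟨_, rfl⟩))
      have e1 : 2 * i + 1 - (i + 1) = i := by ring
      have e2 : i + 1 - 1 = i := by ring
      have e3 : 2 * i + 1 - i = i + 1 := by ring
      rw [relSum, e1, e2, Finset.Icc_self, Finset.sum_singleton, e3, one_smul] at h4
      exact h4
  · change y i * y (N + 1) ∈ annihilator (N + 1)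
    by_cases h : i = N + 1
    · rw [h, y_sq]; exact Submodule.zero_mem _
    · rw [y_mul_y, ← neg_mul]
      exact (annihilator (N + 1)).smul_mem _ (y_mem (by omega))
  · exact relSum_mul_y _ _ (Submodule.subset_span (Or.inl (Or.inr ⟨_, rfl⟩)))
  · exact relSum_mul_y _ _ (Submodule.subset_span (Or.inr ⟨_, rfl⟩))

lemma annihilator_le (N : ℤ) (d : ℕ) :
    annihilator N ≤ (annihilator (N + d)).comap (LinearMap.toSpanSingleton Fermion Fermion
      (yProd N d)) := by
  induction d with
  | zero =>
    intro a ha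
    change a * 1 ∈ annihilator (N + (0 : ℕ))
    simpa using ha
  | succ d ih =>
    intro a ha
    have h2 := annihilator_le_step _ (ih ha)
    change a * yProd N d * y (N + d + 1) ∈ annihilator (N + d + 1) at h2
    change a * (yProd N d * y (N + d + 1)) ∈ annihilator (N + ((d + 1 : ℕ) : ℤ))
    rw [← mul_assoc, Nat.cast_add, Nat.cast_one, ← add_assoc]
    exact h2

lemma annihilator_le_of_le {N M : ℤ} (h : N ≤ M) :
    annihilator N ≤ (annihilator M).comap (LinearMap.toSpanSingleton Fermion Fermion
      (yProd N (M - N).toNat)) := by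
  have h1 := annihilator_le N (M - N).toNat
  have h2 : N + ((M - N).toNat : ℤ) = M := by omega
  rwa [h2] at h1

/-- The map `Υ(N) → Υ(M)`, `N ≤ M`, of modules over the algebra that sends `γ_N` to
`y_{N+1} y_{N+2} ⋯ y_M γ_M`, i.e. the composition of the maps with `γ_{K-1} ↦ y_K γ_K`. -/
def transition (N M : ℤ) (h : N ≤ M) : UpsilonN N →ₗ[Fermion] UpsilonN M :=
  Submodule.mapQ (annihilator N) (annihilator M)
    (LinearMap.toSpanSingleton Fermion Fermion (yProd N (M - N).toNat)) (annihilator_le_of_le h)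

/-- The direct limit `Υ` of the modules `Υ(N)`. -/
def Upsilon : Type := Module.DirectLimit UpsilonN transition

instance : AddCommGroup Upsilon :=
  inferInstanceAs (AddCommGroup (Module.DirectLimit UpsilonN transition))

instance : Module Fermion Upsilon :=
  inferInstanceAs (Module Fermion (Module.DirectLimit UpsilonN transition))

instance : Module ℂ Upsilon := Module.compHom Upsilon (algebraMap ℂ Fermion)

instance : IsScalarTower ℂ Fermion Upsilon :=
  IsScalarTower.of_algebraMap_smul fun _ _ => rfl

/-- The canonical map `Υ(N) → Υ`. -/
def toUpsilon (N : ℤ) : UpsilonN N →ₗ[Fermion] Upsilon :=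
  Module.DirectLimit.of Fermion ℤ UpsilonN transition N

/-- The extreme vector `γ_N`, as a vector of `Υ`. -/
def extreme (N : ℤ) : Upsilon := toUpsilon N (extremeN N)

/-- The (infinite) relations hold on `Υ`: on every vector only finitely many terms do not vanish,
and their sum vanishes. -/
def RelationsHold : Prop :=
  ∀ (s : ℤ) (v : Upsilon),
    {i : ℤ | (x i * y (-i + s)) • v ≠ 0}.Finite ∧
    ∑ᶠ i : ℤ, (x i * y (-i + s)) • v = 0 ∧
    ∑ᶠ i : ℤ, (-1 : ℂ) ^ i • (x i * y (-i + 2 * s + 1)) • v = 0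

/-- The operators `c` and `u` on `Υ`: `[c, u] = 0`, `[c, x_i] = x_i`, `[c, y_i] = y_i`,
`[u, x_i] = -i x_i`, `[u, y_i] = -i y_i`, `c γ_N = -N γ_N`, `u γ_N = (N (N + 1) / 2) γ_N`. -/
structure IsGrading (c u : Module.End ℂ Upsilon) : Prop where
  comm : ∀ v, c (u v) - u (c v) = 0
  c_x : ∀ (i : ℤ) (v : Upsilon), c (x i • v) - x i • c v = x i • v
  c_y : ∀ (i : ℤ) (v : Upsilon), c (y i • v) - y i • c v = y i • v
  u_x : ∀ (i : ℤ) (v : Upsilon), u (x i • v) - x i • u v = (-(i : ℂ)) • x i • v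
  u_y : ∀ (i : ℤ) (v : Upsilon), u (y i • v) - y i • u v = (-(i : ℂ)) • y i • v
  c_extreme : ∀ N : ℤ, c (extreme N) = (-(N : ℂ)) • extreme N
  u_extreme : ∀ N : ℤ, u (extreme N) = ((N : ℂ) * ((N : ℂ) + 1) / 2) • extreme N

/-- The joint eigenspace of `c` and `u` with eigenvalues `n` and `m`. -/
def weightSpace (c u : Module.End ℂ Upsilon) (n m : ℤ) : Submodule ℂ Upsilon :=
  c.eigenspace (n : ℂ) ⊓ u.eigenspace (m : ℂ)

/-- The space is the direct sum of its joint eigenspaces for integral eigenvalues, and all of these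
are finite-dimensional, so that the trace of `q ^ u t ^ c` makes sense as a formal series. -/
def HasCharacter (c u : Module.End ℂ Upsilon) : Prop :=
  DirectSum.IsInternal (fun p : ℤ × ℤ => weightSpace c u p.1 p.2) ∧
    ∀ n m : ℤ, FiniteDimensional ℂ (weightSpace c u n m)

/-- The character `Tr(q ^ u t ^ c)`, as a formal series: `character c u n m` is the coefficient of
`t ^ n q ^ m`. -/
def character (c u : Module.End ℂ Upsilon) (n m : ℤ) : ℕ :=
  Module.finrank ℂ (weightSpace c u n m)

/-- The product `x_{i_1} ⋯ x_{i_l} y_{j_1} ⋯ y_{j_m}` for `A = {i_1 < ⋯ < i_l}` and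
`B = {j_1 < ⋯ < j_m}`. -/
def monomial (A B : Finset ℤ) : Fermion :=
  ((A.sort (· ≤ ·)).map x).prod * ((B.sort (· ≤ ·)).map y).prod

/-- The configuration `S` corresponds to the formal expression
`x_{i_1} ⋯ x_{i_l} y_{j_1} ⋯ y_{j_m} y_{N+1} y_{N+2} ⋯`, with `A = {i_1, …, i_l}` and
`B = {j_1, …, j_m}` bounded by `N`; the particle of index `i` stands in the column `-i` because
configurations have their tails on the left. -/
def Represents (S : Config Row.lower) (N : ℤ) (A B : Finset ℤ) : Prop :=
  (∀ i : ℤ, i ∈ A ↔ (-i, Row.upper) ∈ S.carrier) ∧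
  (∀ j : ℤ, j ∈ B ↔ (j ≤ N ∧ (-j, Row.lower) ∈ S.carrier)) ∧
  (∀ j : ℤ, N < j → (-j, Row.lower) ∈ S.carrier)

end SquareLadder

end

noncomputable section

namespace SquareLadder

/-! ### Dirac sets -/

/-! The character of `Upsilon` is bounded from above by a spanning set and from below by a
surjection onto an explicit space, and a combinatorial injection shows that the bounds meet.

Lower bound. `Fock` has a basis of pairs of a Dirac set and a monomial in commuting variables ψ_t, t
≥ 0. Let V_k create a fermion in column k. Then y_i acts as V_{-i} and x_i as ∑_t ψ_t V_{-i-2t-1}.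
In ∑ x_i y_{s-i} the coefficient of each ψ_t is a sum over V_a V_b with a + b fixed, which vanishes
by antisymmetry; the sign (-1)^i does no harm when s is odd, because exchanging the two factors then
preserves the parity of i (`relSum_smul_vac`, `neg_one_zpow_reflect`). This gives `toFock`, and a
triangular recursion in t recovers every ψ_t (`toFock_surjective`).

Upper bound. The relations express x_i y_j γ_N with |i - j| ≤ 1 through products whose indices
differ by at least 2 (`exists_expansion`). The total index is constant while the sum of squares
grows and stays bounded, so rewriting stops (`word_smul_extreme_mem_aux`). The surviving monomials
are exactly those of configurations (`span_configVector`).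

Comparison. A wall is a particle whose left neighbour stands in the other row; the column just
before it is empty. Closing up one column at every wall leaves a Dirac set of the same charge. The
energy drops by the sum, over the walls, of the number of particles from the wall rightwards. These
numbers are distinct and positive, so they form a partition into distinct parts. By Euler's theorem
it can be traded for a partition into odd parts, that is, a monomial in the ψ_t with ψ_t of weight
2t + 1 (`exists_config_injection`). Hence in each degree there are at most as many configurations as
basis vectors of `Fock`. The images of the configuration vectors span, so they are independent
(`linearIndependent_of_graded`), and `toFock` is an isomorphism. The gradings are carried over from
`Fock`, and flipping the rows settles the other tail. -/

lemma diracE_insert_of_nonneg {Ω : Set ℤ} {k : ℤ} (hk : 0 ≤ k) :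
    diracE (insert k Ω) = insert k (diracE Ω) := by
  ext j; simp only [diracE, Set.mem_inter_iff, Set.mem_insert_iff, Set.mem_ofPred_eq]; grind

lemma diracP_insert_of_nonneg {Ω : Set ℤ} {k : ℤ} (hk : 0 ≤ k) :
    diracP (insert k Ω) = diracP Ω := by
  ext j; simp only [diracP, Set.mem_sdiff, Set.mem_insert_iff, Set.mem_ofPred_eq]; grind

lemma diracE_insert_of_neg {Ω : Set ℤ} {k : ℤ} (hk : k < 0) :
    diracE (insert k Ω) = diracE Ω := by
  ext j; simp only [diracE, Set.mem_inter_iff, Set.mem_insert_iff, Set.mem_ofPred_eq]; grind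

lemma diracP_insert_of_neg {Ω : Set ℤ} {k : ℤ} (hk : k < 0) (h : k ∉ Ω) :
    insert k (diracP (insert k Ω)) = diracP Ω := by
  ext j; simp only [diracP, Set.mem_sdiff, Set.mem_insert_iff, Set.mem_ofPred_eq]; grind

lemma IsDirac.insert {Ω : Set ℤ} (h : IsDirac Ω) (k : ℤ) : IsDirac (insert k Ω) := by
  constructor
  · refine (h.1.insert k).subset ?_
    intro j; simp only [diracE, Set.mem_inter_iff, Set.mem_insert_iff, Set.mem_ofPred_eq]; grind
  · refine h.2.subset ?_
    intro j; simp only [diracP, Set.mem_sdiff, Set.mem_insert_iff, Set.mem_ofPred_eq]; grind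

lemma diracE_disjoint_diracP (Ω : Set ℤ) : Disjoint (diracE Ω) (diracP Ω) := by
  rw [Set.disjoint_left]; intro j; simp only [diracE, diracP, Set.mem_inter_iff, Set.mem_sdiff]
  tauto

lemma diracEnergy_eq {Ω : Set ℤ} (h : IsDirac Ω) :
    diracEnergy Ω = ∑ᶠ k ∈ diracE Ω, |k| + ∑ᶠ k ∈ diracP Ω, |k| :=
  finsum_mem_union (diracE_disjoint_diracP Ω) h.1 h.2

lemma diracCharge_insert {Ω : Set ℤ} (h : IsDirac Ω) {k : ℤ} (hk : k ∉ Ω) :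
    diracCharge (insert k Ω) = diracCharge Ω + 1 := by
  rcases le_or_gt 0 k with h0 | h0
  · rw [diracCharge, diracE_insert_of_nonneg h0, diracP_insert_of_nonneg h0,
      Set.ncard_insert_of_notMem (fun hh => hk hh.1) h.1, diracCharge]
    push_cast; ring
  · have hf : (diracP (insert k Ω)).Finite := (h.insert k).2
    rw [diracCharge, diracE_insert_of_neg h0, diracCharge, ← diracP_insert_of_neg h0 hk,
      Set.ncard_insert_of_notMem (fun hh => hh.2 (Set.mem_insert _ _)) hf]
    push_cast; ring

/-- A new particle at k ≥ 0 adds |k| = k, and filling a hole at k < 0 removes |k| = -k, so both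
cases change the energy by k. -/
lemma diracEnergy_insert {Ω : Set ℤ} (h : IsDirac Ω) {k : ℤ} (hk : k ∉ Ω) :
    diracEnergy (insert k Ω) = diracEnergy Ω + k := by
  rw [diracEnergy_eq h, diracEnergy_eq (h.insert k)]
  rcases le_or_gt 0 k with h0 | h0
  · rw [diracE_insert_of_nonneg h0, diracP_insert_of_nonneg h0,
      finsum_mem_insert _ (fun hh => hk hh.1) h.1, abs_of_nonneg h0]
    ring
  · have hf : (diracP (insert k Ω)).Finite := (h.insert k).2
    rw [diracE_insert_of_neg h0, ← diracP_insert_of_neg h0 hk,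
      finsum_mem_insert _ (fun hh => hh.2 (Set.mem_insert _ _)) hf, abs_of_neg h0]
    ring

lemma isDirac_iio (N : ℤ) : IsDirac (Set.Iio N) := by
  constructor
  · refine (Set.finite_Ico 0 N).subset ?_
    rintro j ⟨h1, h2⟩; exact ⟨h2, h1⟩
  · refine (Set.finite_Ico N 0).subset ?_
    rintro j ⟨h1, h2⟩; exact ⟨not_lt.1 h2, h1⟩

lemma insert_iio (N : ℤ) : insert N (Set.Iio N) = Set.Iio (N + 1) := by
  ext j; simp only [Set.mem_insert_iff, Set.mem_Iio]; omega

lemma dirac_iio (N : ℤ) :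
    diracCharge (Set.Iio N) = N ∧ 2 * diracEnergy (Set.Iio N) = N * (N - 1) := by
  -- The same recursion serves both directions of the induction on N; the energy is doubled to stay
  -- within the integers.
  have step : ∀ M : ℤ, diracCharge (Set.Iio (M + 1)) = diracCharge (Set.Iio M) + 1 ∧
      diracEnergy (Set.Iio (M + 1)) = diracEnergy (Set.Iio M) + M := fun M => by
    rw [← insert_iio]
    exact ⟨diracCharge_insert (isDirac_iio M) (by simp),
      diracEnergy_insert (isDirac_iio M) (by simp)⟩
  induction N with
  | zero =>
    have h1 : diracE (Set.Iio 0) = ∅ := by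
      ext j; simp only [diracE, Set.mem_inter_iff, Set.mem_Iio, Set.mem_ofPred_eq]; grind
    have h2 : diracP (Set.Iio 0) = ∅ := by
      ext j; simp only [diracP, Set.mem_sdiff, Set.mem_Iio, Set.mem_ofPred_eq]; grind
    simp [diracCharge, diracEnergy, h1, h2]
  | succ n ih =>
    obtain ⟨h1, h2⟩ := step n
    exact ⟨by omega, by rw [h2, mul_add, ih.2]; ring⟩
  | pred n ih =>
    obtain ⟨h1, h2⟩ := step (-n - 1)
    rw [sub_add_cancel] at h1 h2
    refine ⟨by omega, ?_⟩
    have h3 := ih.2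
    rw [h2, mul_add] at h3
    rw [eq_sub_of_add_eq h3]; ring

/-- Every Dirac set has this form for any N far enough to the left (`IsDirac.eq_union`). Charges and
energies are computed through it, without separating particles from holes. -/
lemma iio_union_finset (N : ℤ) (T : Finset ℤ) (hT : ∀ k ∈ T, N ≤ k) :
    IsDirac (Set.Iio N ∪ T) ∧ diracCharge (Set.Iio N ∪ T) = N + T.card ∧
      2 * diracEnergy (Set.Iio N ∪ T) = N * (N - 1) + 2 * ∑ k ∈ T, k := by
  induction T using Finset.induction_on with
  | empty => simpa using ⟨isDirac_iio N, dirac_iio N⟩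
  | insert k T hk ih =>
    obtain ⟨h1, h2, h3⟩ := ih fun j hj => hT j (Finset.mem_insert_of_mem hj)
    have hkN := hT k (Finset.mem_insert_self _ _)
    have hk' : k ∉ Set.Iio N ∪ (T : Set ℤ) := by
      rintro (h | h)
      · exact absurd h (not_lt.2 hkN)
      · exact hk h
    rw [Finset.coe_insert, Set.union_insert, diracCharge_insert h1 hk', diracEnergy_insert h1 hk',
      Finset.card_insert_of_notMem hk, Finset.sum_insert hk]
    exact ⟨h1.insert k, by push_cast; omega, by linarith⟩

lemma IsDirac.exists_iio_subset {Ω : Set ℤ} (h : IsDirac Ω) : ∃ N : ℤ, Set.Iio N ⊆ Ω := by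
  obtain ⟨N, hN⟩ := h.2.bddBelow
  refine ⟨min N 0, fun j hj => ?_⟩
  rw [Set.mem_Iio, lt_min_iff] at hj
  by_contra hc
  exact absurd (hN (⟨hj.2, hc⟩ : j ∈ diracP Ω)) (not_le.2 hj.1)

lemma IsDirac.finite_ge {Ω : Set ℤ} (h : IsDirac Ω) (N : ℤ) : {k | k ∈ Ω ∧ N ≤ k}.Finite := by
  refine (h.1.union (Set.finite_Ico N 0)).subset ?_
  rintro j ⟨h1, h2⟩
  rcases le_or_gt 0 j with h0 | h0
  · exact Or.inl ⟨h1, h0⟩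
  · exact Or.inr ⟨h2, h0⟩

lemma IsDirac.eq_union {Ω : Set ℤ} (h : IsDirac Ω) {N : ℤ} (hN : Set.Iio N ⊆ Ω) :
    Ω = Set.Iio N ∪ ((h.finite_ge N).toFinset : Set ℤ) := by
  ext j
  simp only [Set.Finite.coe_toFinset, Set.mem_union, Set.mem_Iio, Set.mem_ofPred_eq]
  constructor
  · intro hj; rcases lt_or_ge j N with h | h
    · exact Or.inl h
    · exact Or.inr ⟨hj, h⟩
  · rintro (h | h)
    · exact hN h
    · exact h.1

lemma IsDirac.charge_energy {Ω : Set ℤ} (h : IsDirac Ω) {N : ℤ} (hN : Set.Iio N ⊆ Ω) :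
    diracCharge Ω = N + (h.finite_ge N).toFinset.card ∧
      2 * diracEnergy Ω = N * (N - 1) + 2 * ∑ k ∈ (h.finite_ge N).toFinset, k := by
  have h1 := iio_union_finset N (h.finite_ge N).toFinset (fun k hk => by simp at hk; exact hk.2)
  rw [← h.eq_union hN] at h1
  exact h1.2

end SquareLadder

end

noncomputable section

namespace SquareLadder

open Finsupp

/-! ### The Fock space -/

/-- Dirac sets, bundled. -/
abbrev DiracSet : Type := {Ω : Set ℤ // IsDirac Ω}

/-- The space with a basis formed by the pairs of a Dirac set and a monomial in commuting variables
`ψ_t`, `t ≥ 0`. -/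
abbrev Fock : Type := (DiracSet × (ℕ →₀ ℕ)) →₀ ℂ

/-- Adding a column to a Dirac set. -/
def DiracSet.insert (k : ℤ) (Ω : DiracSet) : DiracSet := ⟨Insert.insert k Ω.1, Ω.2.insert k⟩

/-- The sign `(-1) ^ #{j ∈ Ω | k < j}`. -/
def sgn (k : ℤ) (Ω : DiracSet) : ℂ := (-1) ^ {j | j ∈ Ω.1 ∧ k < j}.ncard

lemma sgn_ne_zero (k : ℤ) (Ω : DiracSet) : sgn k Ω ≠ 0 := pow_ne_zero _ (by norm_num)

lemma sgn_insert_of_lt {k m : ℤ} {Ω : DiracSet} (hm : m ∉ Ω.1) (h : k < m) :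
    sgn k (Ω.insert m) = -sgn k Ω := by
  have e : {j | j ∈ (Ω.insert m).1 ∧ k < j} = Insert.insert m {j | j ∈ Ω.1 ∧ k < j} := by
    ext j; simp only [DiracSet.insert, Set.mem_insert_iff, Set.mem_ofPred_eq]; grind
  have hf : {j | j ∈ Ω.1 ∧ k < j}.Finite := (Ω.2.finite_ge k).subset fun j hj => ⟨hj.1, hj.2.le⟩
  rw [sgn, e, Set.ncard_insert_of_notMem (fun hh => hm hh.1) hf, pow_succ, sgn]
  ring

lemma sgn_insert_of_gt {k m : ℤ} {Ω : DiracSet} (h : m < k) :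
    sgn k (Ω.insert m) = sgn k Ω := by
  have e : {j | j ∈ (Ω.insert m).1 ∧ k < j} = {j | j ∈ Ω.1 ∧ k < j} := by
    ext j; simp only [DiracSet.insert, Set.mem_insert_iff, Set.mem_ofPred_eq]; grind
  rw [sgn, e, sgn]

open Classical in
/-- The operator that creates a particle in column `k`. -/
def create (k : ℤ) : Module.End ℂ Fock :=
  linearCombination ℂ fun p : DiracSet × (ℕ →₀ ℕ) =>
    if k ∈ p.1.1 then 0 else single (p.1.insert k, p.2) (sgn k p.1)

/-- Multiplication by the variable `ψ_t`. -/
def boson (t : ℕ) : Module.End ℂ Fock :=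
  lmapDomain ℂ ℂ fun p : DiracSet × (ℕ →₀ ℕ) => (p.1, p.2 + single t 1)

lemma create_of_mem {k : ℤ} {Ω : DiracSet} (h : k ∈ Ω.1) (f : ℕ →₀ ℕ) (c : ℂ) :
    create k (single (Ω, f) c) = 0 := by
  simp [create, linearCombination_single, h]

lemma create_of_notMem {k : ℤ} {Ω : DiracSet} (h : k ∉ Ω.1) (f : ℕ →₀ ℕ) (c : ℂ) :
    create k (single (Ω, f) c) = single (Ω.insert k, f) (c * sgn k Ω) := by
  simp [create, linearCombination_single, h]

lemma boson_single (t : ℕ) (Ω : DiracSet) (f : ℕ →₀ ℕ) (c : ℂ) :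
    boson t (single (Ω, f) c) = single (Ω, f + single t 1) c := by
  simp [boson]

lemma create_boson (k : ℤ) (t : ℕ) (v : Fock) : create k (boson t v) = boson t (create k v) := by
  induction v using Finsupp.induction_linear with
  | zero => simp
  | add v w hv hw => simp only [map_add, hv, hw]
  | single p c =>
    obtain ⟨Ω, f⟩ := p
    rw [boson_single]
    by_cases h : k ∈ Ω.1
    · rw [create_of_mem h, create_of_mem h, map_zero]
    · rw [create_of_notMem h, create_of_notMem h, boson_single]

lemma boson_boson (s t : ℕ) (v : Fock) : boson s (boson t v) = boson t (boson s v) := by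
  induction v using Finsupp.induction_linear with
  | zero => simp
  | add v w hv hw => simp only [map_add, hv, hw]
  | single p c =>
    obtain ⟨Ω, f⟩ := p
    simp only [boson_single, add_assoc, add_comm (single s 1)]

lemma create_create_self (k : ℤ) (v : Fock) : create k (create k v) = 0 := by
  induction v using Finsupp.induction_linear with
  | zero => simp
  | add v w hv hw => simp only [map_add, hv, hw, add_zero]
  | single p c =>
    obtain ⟨Ω, f⟩ := p
    by_cases h : k ∈ Ω.1
    · rw [create_of_mem h, map_zero]
    · rw [create_of_notMem h, create_of_mem (Set.mem_insert _ _)]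

lemma DiracSet.insert_comm (k m : ℤ) (Ω : DiracSet) :
    (Ω.insert k).insert m = (Ω.insert m).insert k := Subtype.ext (Set.insert_comm _ _ _)

/-- For k < m, filling m puts one more particle to the right of k and flips the sign of k, while
filling k leaves the sign of m unchanged. -/
lemma create_create (k m : ℤ) (v : Fock) : create k (create m v) = -create m (create k v) := by
  wlog hkm : k ≤ m generalizing k m
  · rw [this m k (by omega), neg_neg]
  rcases hkm.eq_or_lt with rfl | hlt
  · simp [create_create_self]
  induction v using Finsupp.induction_linear with
  | zero => simp
  | add v w hv hw => simp only [map_add, hv, hw]; abel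
  | single p c =>
    obtain ⟨Ω, f⟩ := p
    by_cases hm : m ∈ Ω.1
    · have hm' : m ∈ (Ω.insert k).1 := Set.mem_insert_of_mem _ hm
      by_cases hk : k ∈ Ω.1
      · rw [create_of_mem hm, create_of_mem hk]; simp
      · rw [create_of_mem hm, create_of_notMem hk, create_of_mem hm']; simp
    · by_cases hk : k ∈ Ω.1
      · have hk' : k ∈ (Ω.insert m).1 := Set.mem_insert_of_mem _ hk
        rw [create_of_mem hk, create_of_notMem hm, create_of_mem hk']; simp
      · have hk' : k ∉ (Ω.insert m).1 := by
          rintro (h | h)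
          · omega
          · exact hk h
        have hm' : m ∉ (Ω.insert k).1 := by
          rintro (h | h)
          · omega
          · exact hm h
        rw [create_of_notMem hm, create_of_notMem hk', create_of_notMem hk, create_of_notMem hm',
          sgn_insert_of_lt hm hlt, sgn_insert_of_gt hlt, ← Finsupp.single_neg, Ω.insert_comm]
        congr 1; ring

/-! ### Local finiteness and the operators of the upper row. -/

/-- The vector is annihilated by the creation of particles to the left of the column `K`. -/
def FilledBelow (K : ℤ) (v : Fock) : Prop := ∀ k < K, create k v = 0

lemma FilledBelow.mono {K L : ℤ} {v : Fock} (h : FilledBelow K v) (hL : L ≤ K) :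
    FilledBelow L v := fun k hk => h k (hk.trans_le hL)

lemma FilledBelow.add {K : ℤ} {v w : Fock} (hv : FilledBelow K v) (hw : FilledBelow K w) :
    FilledBelow K (v + w) := fun k hk => by rw [map_add, hv k hk, hw k hk, add_zero]

lemma FilledBelow.sum {K : ℤ} {ι : Type*} {s : Finset ι} {v : ι → Fock}
    (h : ∀ i ∈ s, FilledBelow K (v i)) : FilledBelow K (∑ i ∈ s, v i) := fun k hk => by
  rw [map_sum]; exact Finset.sum_eq_zero fun i hi => h i hi k hk

lemma FilledBelow.create {K : ℤ} {v : Fock} (h : FilledBelow K v) (m : ℤ) :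
    FilledBelow K (create m v) := fun k hk => by
  rw [create_create, h k hk, map_zero, neg_zero]

lemma FilledBelow.boson {K : ℤ} {v : Fock} (h : FilledBelow K v) (t : ℕ) :
    FilledBelow K (boson t v) := fun k hk => by rw [create_boson, h k hk, map_zero]

/-- This makes the sums over t finite. Since `create` and `boson` preserve the bound K, both sides
of an operator identity can be truncated at the same place. -/
lemma exists_filledBelow (v : Fock) : ∃ K, FilledBelow K v := by
  induction v using Finsupp.induction_linear with
  | zero => exact ⟨0, fun k _ => map_zero _⟩
  | add v w hv hw =>
    obtain ⟨K, hK⟩ := hv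
    obtain ⟨L, hL⟩ := hw
    exact ⟨min K L, (hK.mono (min_le_left _ _)).add (hL.mono (min_le_right _ _))⟩
  | single p c =>
    obtain ⟨Ω, f⟩ := p
    obtain ⟨N, hN⟩ := Ω.2.exists_iio_subset
    exact ⟨N, fun k hk => create_of_mem (hN hk) _ _⟩

/-- The term of index `t` of the operator `∑_t ψ_t V_{i - 2 t - 1}`, where `V_k` is the creation of
a particle in column `k`. -/
def upperTerm (i : ℤ) (t : ℕ) : Module.End ℂ Fock := boson t ∘ₗ create (i - 2 * t - 1)

lemma FilledBelow.upperTerm {K : ℤ} {v : Fock} (h : FilledBelow K v) (i : ℤ) (t : ℕ) :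
    FilledBelow K (upperTerm i t v) := (h.create _).boson t

lemma FilledBelow.upperTerm_eq_zero {K : ℤ} {v : Fock} (h : FilledBelow K v) {i : ℤ} {t : ℕ}
    (ht : i < K + 2 * t + 1) : SquareLadder.upperTerm i t v = 0 := by
  rw [SquareLadder.upperTerm, LinearMap.comp_apply, h _ (by omega), map_zero]

lemma FilledBelow.support_subset {K : ℤ} {v : Fock} (h : FilledBelow K v) {i : ℤ} {n : ℕ}
    (hn : i < K + 2 * n + 1) :
    (Function.support fun t => SquareLadder.upperTerm i t v) ⊆ Finset.range n := by
  intro t ht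
  by_contra hc
  rw [Finset.coe_range, Set.mem_Iio, not_lt] at hc
  exact ht (h.upperTerm_eq_zero (by omega))

lemma upperTerm_support_finite (i : ℤ) (v : Fock) :
    (Function.support fun t => upperTerm i t v).Finite := by
  obtain ⟨K, hK⟩ := exists_filledBelow v
  exact (Finset.finite_toSet _).subset (hK.support_subset (n := (i - K).toNat) (by omega))

/-- The operator `∑_t ψ_t V_{i - 2 t - 1}`. -/
def upperOp (i : ℤ) : Module.End ℂ Fock where
  toFun v := ∑ᶠ t, upperTerm i t v
  map_add' v w := by
    simp only [map_add]
    exact finsum_add_distrib (upperTerm_support_finite i v) (upperTerm_support_finite i w)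
  map_smul' c v := by
    simp only [map_smul, RingHom.id_apply]
    exact (smul_finsum c _).symm

lemma FilledBelow.upperOp_eq {K : ℤ} {v : Fock} (h : FilledBelow K v) {i : ℤ} {n : ℕ}
    (hn : i < K + 2 * n + 1) : upperOp i v = ∑ t ∈ Finset.range n, SquareLadder.upperTerm i t v :=
  finsum_eq_sum_of_support_subset _ (h.support_subset hn)

lemma FilledBelow.upperOp {K : ℤ} {v : Fock} (h : FilledBelow K v) (i : ℤ) :
    FilledBelow K (upperOp i v) := by
  rw [h.upperOp_eq (n := (i - K).toNat) (by omega)]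
  exact FilledBelow.sum fun t _ => h.upperTerm i t

lemma upperOp_boson (i : ℤ) (t : ℕ) (v : Fock) : upperOp i (boson t v) = boson t (upperOp i v) := by
  obtain ⟨K, hK⟩ := exists_filledBelow v
  rw [hK.upperOp_eq (n := (i - K).toNat) (by omega),
    (hK.boson t).upperOp_eq (n := (i - K).toNat) (by omega), map_sum]
  refine Finset.sum_congr rfl fun s _ => ?_
  simp only [upperTerm, LinearMap.comp_apply, create_boson, boson_boson t]

lemma upperTerm_create (i : ℤ) (t : ℕ) (k : ℤ) (v : Fock) :
    upperTerm i t (create k v) = -create k (upperTerm i t v) := by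
  simp only [upperTerm, LinearMap.comp_apply, create_boson, create_create _ k, map_neg]

lemma upperOp_create (i k : ℤ) (v : Fock) : upperOp i (create k v) = -create k (upperOp i v) := by
  obtain ⟨K, hK⟩ := exists_filledBelow v
  rw [hK.upperOp_eq (n := (i - K).toNat) (by omega),
    (hK.create k).upperOp_eq (n := (i - K).toNat) (by omega), map_sum, ← Finset.sum_neg_distrib]
  exact Finset.sum_congr rfl fun t _ => upperTerm_create i t k v

lemma upperOp_upperTerm (i j : ℤ) (t : ℕ) (v : Fock) :
    upperOp i (upperTerm j t v) = -upperTerm j t (upperOp i v) := by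
  simp only [upperTerm, LinearMap.comp_apply, upperOp_boson, upperOp_create, map_neg]

/-- The ψ's commute with everything, so the anticommutation is inherited term by term from the V's.
-/
lemma upperOp_upperOp (i j : ℤ) (v : Fock) : upperOp i (upperOp j v) = -upperOp j (upperOp i v) := by
  obtain ⟨K, hK⟩ := exists_filledBelow v
  rw [hK.upperOp_eq (n := (j - K).toNat) (by omega),
    (hK.upperOp i).upperOp_eq (n := (j - K).toNat) (by omega), map_sum, ← Finset.sum_neg_distrib]
  exact Finset.sum_congr rfl fun t _ => upperOp_upperTerm i j t v

/-! ### The action of the exterior algebra on the Fock space. -/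

/-- The operator on the Fock space that corresponds to a generator. -/
def genOp : ℤ × Row → Module.End ℂ Fock
  | (i, Row.upper) => upperOp (-i)
  | (i, Row.lower) => create (-i)

lemma genOp_anticomm (a b : ℤ × Row) : genOp a * genOp b + genOp b * genOp a = 0 := by
  obtain ⟨i, r⟩ := a
  obtain ⟨j, s⟩ := b
  refine LinearMap.ext fun v => ?_
  rw [LinearMap.add_apply, LinearMap.zero_apply, add_eq_zero_iff_eq_neg]
  rcases r <;> rcases s <;> simp only [genOp, Module.End.mul_apply]
  · exact upperOp_upperOp _ _ _
  · exact upperOp_create _ _ _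
  · rw [upperOp_create, neg_neg]
  · exact create_create _ _ _

/-- The linear extension of `genOp`. -/
def genLin : ((ℤ × Row) →₀ ℂ) →ₗ[ℂ] Module.End ℂ Fock := linearCombination ℂ genOp

lemma genLin_anticomm (a b : (ℤ × Row) →₀ ℂ) : genLin a * genLin b + genLin b * genLin a = 0 := by
  induction a using Finsupp.induction_linear with
  | zero => simp
  | add a a' h h' =>
    rw [map_add, add_mul, mul_add, add_add_add_comm, h, h', add_zero]
  | single p c =>
    induction b using Finsupp.induction_linear with
    | zero => simp
    | add b b' h h' => rw [map_add, add_mul, mul_add, add_add_add_comm, h, h', add_zero]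
    | single q d =>
      simp only [genLin, linearCombination_single, smul_mul_assoc, mul_smul_comm, smul_comm c d]
      rw [← smul_add, ← smul_add, genOp_anticomm, smul_zero, smul_zero]

lemma genLin_sq (a : (ℤ × Row) →₀ ℂ) : genLin a * genLin a = 0 := by
  refine LinearMap.ext fun v => ?_
  have h := LinearMap.congr_fun (genLin_anticomm a a) v
  rw [LinearMap.add_apply, LinearMap.zero_apply] at h
  exact self_eq_neg.1 (eq_neg_of_add_eq_zero_left h)

/-- The action of the algebra on the Fock space. -/
def fockAction : Fermion →ₐ[ℂ] Module.End ℂ Fock := ExteriorAlgebra.lift ℂ ⟨genLin, genLin_sq⟩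

lemma fockAction_x (i : ℤ) : fockAction (x i) = upperOp (-i) := by
  simp [fockAction, x, genLin, genOp]

lemma fockAction_y (i : ℤ) : fockAction (y i) = create (-i) := by
  simp [fockAction, y, genLin, genOp]

instance : Module Fermion Fock := Module.compHom Fock fockAction.toRingHom

lemma fermion_smul_def (a : Fermion) (v : Fock) : a • v = fockAction a v := rfl

instance : IsScalarTower ℂ Fermion Fock :=
  ⟨fun c a v => by rw [fermion_smul_def, map_smul]; rfl⟩

lemma x_smul (i : ℤ) (v : Fock) : x i • v = upperOp (-i) v := by
  rw [fermion_smul_def, fockAction_x]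

lemma y_smul (i : ℤ) (v : Fock) : y i • v = create (-i) v := by
  rw [fermion_smul_def, fockAction_y]

lemma fermion_induction {C : Fermion → Prop} (scalar : ∀ c : ℂ, C (algebraMap ℂ Fermion c))
    (hx : ∀ i, C (x i)) (hy : ∀ i, C (y i)) (mul : ∀ a b, C a → C b → C (a * b))
    (add : ∀ a b, C a → C b → C (a + b)) (a : Fermion) : C a := by
  refine ExteriorAlgebra.induction scalar (fun m => ?_) mul add a
  induction m using Finsupp.induction_linear with
  | zero => rw [map_zero]; simpa using scalar 0
  | add a b ha hb => rw [map_add]; exact add _ _ ha hb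
  | single p c =>
    have e : ExteriorAlgebra.ι ℂ (single p c) =
        algebraMap ℂ Fermion c * ExteriorAlgebra.ι ℂ (single p 1) := by
      rw [← Algebra.smul_def, ← map_smul, smul_single, smul_eq_mul, mul_one]
    rw [e]
    refine mul _ _ (scalar c) ?_
    obtain ⟨i, r⟩ := p
    cases r
    · exact hx i
    · exact hy i

lemma algebraMap_smul_fock (c : ℂ) (v : Fock) : algebraMap ℂ Fermion c • v = c • v := by
  rw [Algebra.algebraMap_eq_smul_one, smul_assoc, one_smul]

/-- Since each ψ_t commutes with the whole algebra, the image of `toFock` is stable under ψ_t as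
soon as it contains all ψ_t `vac N`. -/
lemma smul_boson (a : Fermion) (t : ℕ) (v : Fock) : a • boson t v = boson t (a • v) := by
  induction a using fermion_induction generalizing v with
  | scalar c => simp only [algebraMap_smul_fock, map_smul]
  | hx i => simp only [x_smul, upperOp_boson]
  | hy i => simp only [y_smul, create_boson]
  | mul a b ha hb => rw [mul_smul, mul_smul, hb, ha]
  | add a b ha hb => rw [add_smul, add_smul, ha, hb, map_add]

end SquareLadder

end

noncomputable section

namespace SquareLadder

open Finsupp

/-! ### The map from `Υ` to the Fock space -/

/-- The vector of the Fock space that corresponds to `γ_N`. -/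
def vac (N : ℤ) : Fock := single (⟨Set.Iio (-N), isDirac_iio _⟩, 0) 1

lemma filledBelow_vac (N : ℤ) : FilledBelow (-N) (vac N) := fun _ hk => create_of_mem hk _ _

lemma y_smul_vac (N : ℤ) : y (N + 1) • vac (N + 1) = vac N := by
  have h : -(N + 1) ∉ Set.Iio (-(N + 1)) := by simp
  have hs : sgn (-(N + 1)) ⟨Set.Iio (-(N + 1)), isDirac_iio _⟩ = 1 := by
    have e : {j : ℤ | j ∈ Set.Iio (-(N + 1)) ∧ -(N + 1) < j} = ∅ := by
      ext j; simp only [Set.mem_Iio, Set.mem_ofPred_eq, Set.mem_empty_iff_false, iff_false]; omega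
    rw [sgn, e, Set.ncard_empty, pow_zero]
  have hi : DiracSet.insert (-(N + 1)) ⟨Set.Iio (-(N + 1)), isDirac_iio _⟩ =
      ⟨Set.Iio (-N), isDirac_iio _⟩ := by
    refine Subtype.ext ((insert_iio _).trans ?_)
    rw [neg_add, neg_add_cancel_right]
  rw [y_smul, vac, create_of_notMem h, hs, hi, mul_one, vac]

lemma yProd_smul_vac (N : ℤ) (d : ℕ) : yProd N d • vac (N + d) = vac N := by
  induction d with
  | zero => simp [yProd]
  | succ d ih =>
    rw [yProd, mul_smul, Nat.cast_add, Nat.cast_one, ← add_assoc, y_smul_vac, ih]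

/-- The coefficient of ψ_t is ∑ w_i V_{-i-2t-1} V_{i-s}. The reflection i ↦ s - (2t+1) - i exchanges
the two columns, so if w is invariant under it the sum equals its own negative. -/
lemma relSum_smul_vac (N : ℤ) (w : ℤ → ℂ) (s : ℤ)
    (hw : ∀ (i : ℤ) (t : ℕ), w (s - (2 * t + 1) - i) = w i) : relSum N w s • vac N = 0 := by
  have hx : ∀ i ∈ Finset.Icc (s - N) (N - 1), (w i • (x i * y (s - i))) • vac N =
      ∑ t ∈ Finset.range (2 * N - s).toNat,
        boson t (w i • create (-i - 2 * t - 1) (create (-(s - i)) (vac N))) := by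
    intro i hi
    rw [Finset.mem_Icc] at hi
    -- One cut-off in t valid for all i ≥ s - N, so that the two summations can be exchanged.
    rw [smul_assoc, mul_smul, y_smul, x_smul,
      ((filledBelow_vac N).create _).upperOp_eq (n := (2 * N - s).toNat) (by omega),
      Finset.smul_sum]
    refine Finset.sum_congr rfl fun t _ => ?_
    rw [upperTerm, LinearMap.comp_apply, map_smul]
  rw [relSum, Finset.sum_smul, Finset.sum_congr rfl hx, Finset.sum_comm]
  refine Finset.sum_eq_zero fun t _ => ?_
  rw [← map_sum]
  -- For i > N - 2t - 1 the column -i-2t-1 is already filled. The remaining interval is stable under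
  -- the reflection.
  have hsub : Finset.Icc (s - N) (N - 2 * t - 1) ⊆ Finset.Icc (s - N) (N - 1) :=
    Finset.Icc_subset_Icc le_rfl (by omega)
  rw [← Finset.sum_subset hsub, ← map_zero (boson t)]
  · congr 1
    refine self_eq_neg.1 ?_
    rw [← Finset.sum_neg_distrib]
    refine Finset.sum_equiv (Equiv.subLeft (s - (2 * t + 1))) (fun i => ?_) (fun i _ => ?_)
    · simp only [Finset.mem_Icc, Equiv.subLeft_apply]; omega
    · rw [Equiv.subLeft_apply, hw, ← smul_neg, create_create]
      have e1 : -(s - (2 * t + 1) - i) - 2 * t - 1 = -(s - i) := by ring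
      have e2 : -(s - (s - (2 * t + 1) - i)) = -i - 2 * t - 1 := by ring
      rw [e1, e2]
  · intro i hi hi'
    rw [Finset.mem_Icc] at hi hi'
    rw [((filledBelow_vac N).create _) _ (by omega), smul_zero]

/-- Both 2s+1 and 2t+1 are odd, so the reflection preserves the parity of i. This is why the
alternating relations are imposed only for odd index sums. -/
lemma neg_one_zpow_reflect (s i : ℤ) (t : ℕ) :
    (-1 : ℂ) ^ (2 * s + 1 - (2 * t + 1) - i) = (-1) ^ i := by
  have e : 2 * s + 1 - (2 * (t : ℤ) + 1) - i = 2 * (s - t - i) + i := by ring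
  have h1 : (-1 : ℂ) ≠ 0 := by norm_num
  rw [e, zpow_add₀ h1, zpow_mul]
  norm_num

lemma annihilator_le_ker (N : ℤ) :
    annihilator N ≤ LinearMap.ker (LinearMap.toSpanSingleton Fermion Fock (vac N)) := by
  rw [annihilator, Submodule.span_le]
  rintro a (((⟨i, hi, rfl⟩ | ⟨i, hi, rfl⟩) | ⟨s, rfl⟩) | ⟨s, rfl⟩)
  · change x i • vac N = 0
    -- The rightmost column that x_i can fill is -i-1, which lies in the filled region -∞ < k < -N
    -- exactly when i > N - 1.
    rw [x_smul, (filledBelow_vac N).upperOp_eq (n := 0) (by push_cast; omega), Finset.sum_range_zero]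
  · change y i • vac N = 0
    rw [y_smul, filledBelow_vac N _ (by omega)]
  · exact relSum_smul_vac _ _ _ fun _ _ => rfl
  · exact relSum_smul_vac _ _ _ fun i t => neg_one_zpow_reflect s i t

/-- The map `Υ(N) → Fock`. -/
def toFockN (N : ℤ) : UpsilonN N →ₗ[Fermion] Fock :=
  (annihilator N).liftQ (LinearMap.toSpanSingleton Fermion Fock (vac N)) (annihilator_le_ker N)

lemma toFockN_mk (N : ℤ) (a : Fermion) : toFockN N ((annihilator N).mkQ a) = a • vac N := rfl

lemma toFockN_transition (N M : ℤ) (h : N ≤ M) (z : UpsilonN N) :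
    toFockN M (transition N M h z) = toFockN N z := by
  obtain ⟨a, rfl⟩ := (annihilator N).mkQ_surjective z
  change (a * yProd N (M - N).toNat) • vac M = a • vac N
  have e := yProd_smul_vac N (M - N).toNat
  rw [show N + ((M - N).toNat : ℤ) = M by omega] at e
  rw [mul_smul, e]

/-- The map `Υ → Fock`. -/
def toFock : Upsilon →ₗ[Fermion] Fock :=
  Module.DirectLimit.lift Fermion ℤ UpsilonN transition toFockN toFockN_transition

lemma toFock_extreme (N : ℤ) : toFock (extreme N) = vac N := by
  have h : toFock (extreme N) = toFockN N (extremeN N) := Module.DirectLimit.lift_of _ _ _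
  rw [h, extremeN, toFockN_mk, one_smul]

lemma exists_smul_extreme (v : Upsilon) : ∃ (N : ℤ) (a : Fermion), v = a • extreme N := by
  obtain ⟨N, z, hz⟩ := Module.DirectLimit.exists_of (G := UpsilonN) (f := transition) v
  obtain ⟨a, rfl⟩ := (annihilator N).mkQ_surjective z
  refine ⟨N, a, hz.symm.trans ?_⟩
  rw [extreme, ← map_smul, extremeN, ← map_smul, smul_eq_mul, mul_one]
  rfl

lemma smul_extreme_eq_zero {N : ℤ} {a : Fermion} (h : a ∈ annihilator N) : a • extreme N = 0 := by
  rw [extreme, ← map_smul, extremeN, ← map_smul, smul_eq_mul, mul_one, Submodule.mkQ_apply,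
    (Submodule.Quotient.mk_eq_zero _).2 h, map_zero]

lemma yProd_smul_extreme (N : ℤ) (d : ℕ) : yProd N d • extreme (N + d) = extreme N := by
  have h : N ≤ N + d := by omega
  have e : transition N (N + d) h (extremeN N) = yProd N d • extremeN (N + d) := by
    rw [extremeN, extremeN, ← map_smul, smul_eq_mul, mul_one, transition]
    change (annihilator (N + d)).mkQ (1 * yProd N (N + d - N).toNat) = _
    rw [one_mul, add_sub_cancel_left, Int.toNat_natCast]
  rw [extreme, ← map_smul, ← e]
  exact Module.DirectLimit.of_f

/-! ### Surjectivity -/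

/-- In x_{N-2t} `vac (N + 1)` only ψ_0, …, ψ_t occur, and the coefficient of ψ_t is `vac N`. The
terms with s < t are V_k ψ_s `vac (N + 1)`, in the image by induction. -/
lemma boson_vac_mem (t : ℕ) (N : ℤ) : boson t (vac N) ∈ LinearMap.range toFock := by
  induction t using Nat.strong_induction_on generalizing N with
  | _ t ih =>
    have hmem : ∀ K, vac K ∈ LinearMap.range toFock := fun K => ⟨_, toFock_extreme K⟩
    have h1 : x (N - 2 * t) • vac (N + 1) ∈ LinearMap.range toFock :=
      Submodule.smul_mem _ _ (hmem _)
    rw [x_smul, (filledBelow_vac _).upperOp_eq (n := t + 1) (by push_cast; omega),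
      Finset.sum_range_succ] at h1
    have h2 : upperTerm (-(N - 2 * t)) t (vac (N + 1)) = boson t (vac N) := by
      rw [upperTerm, LinearMap.comp_apply, ← y_smul_vac N, y_smul]
      congr 3; ring
    rw [h2] at h1
    refine (Submodule.add_mem_iff_right _ (Submodule.sum_mem _ fun s hs => ?_)).1 h1
    have h3 := Submodule.smul_mem _ (y (-(-(N - 2 * t) - 2 * s - 1))) (ih s (Finset.mem_range.1 hs) (N + 1))
    rwa [y_smul, neg_neg, create_boson] at h3

lemma boson_mem (t : ℕ) {v : Fock} (hv : v ∈ LinearMap.range toFock) :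
    boson t v ∈ LinearMap.range toFock := by
  obtain ⟨z, rfl⟩ := hv
  obtain ⟨N, a, rfl⟩ := exists_smul_extreme z
  rw [map_smul, toFock_extreme, ← smul_boson]
  exact Submodule.smul_mem _ _ (boson_vac_mem t N)

lemma complex_smul_mem (c : ℂ) {v : Fock} (hv : v ∈ LinearMap.range toFock) :
    c • v ∈ LinearMap.range toFock := by
  rw [← algebraMap_smul_fock]; exact Submodule.smul_mem _ _ hv

lemma single_zero_mem (Ω : DiracSet) : (single (Ω, 0) 1 : Fock) ∈ LinearMap.range toFock := by
  obtain ⟨Ω, hΩ⟩ := Ω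
  obtain ⟨N, hN⟩ := hΩ.exists_iio_subset
  have h := hΩ.eq_union hN
  generalize (hΩ.finite_ge N).toFinset = T at h
  induction T using Finset.induction_on generalizing Ω with
  | empty =>
    simp only [Finset.coe_empty, Set.union_empty] at h
    subst h
    refine ⟨extreme (-N), (toFock_extreme _).trans ?_⟩
    simp only [vac, neg_neg]
  | insert k T hk ih =>
    rw [Finset.coe_insert, Set.union_insert] at h
    -- Proved directly, because k may already lie in `Iio N`, in which case the insertion changes
    -- nothing.
    have hT : IsDirac (Set.Iio N ∪ T) := by
      constructor
      · exact hΩ.1.subset fun j hj => ⟨h ▸ Set.mem_insert_of_mem _ hj.1, hj.2⟩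
      · exact (isDirac_iio N).2.subset fun j hj => ⟨hj.1, fun hh => hj.2 (Or.inl hh)⟩
    have h1 := ih _ hT Set.subset_union_left rfl
    subst h
    by_cases hkT : k ∈ Set.Iio N ∪ (T : Set ℤ)
    · have e : insert k (Set.Iio N ∪ (T : Set ℤ)) = Set.Iio N ∪ (T : Set ℤ) :=
        Set.insert_eq_of_mem hkT
      simpa only [e] using h1
    · have h2 := Submodule.smul_mem _ (y (-k)) h1
      rw [y_smul, neg_neg, create_of_notMem hkT] at h2
      have h3 := complex_smul_mem (1 * sgn k ⟨_, hT⟩)⁻¹ h2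
      rwa [smul_single, smul_eq_mul,
        inv_mul_cancel₀ (mul_ne_zero one_ne_zero (sgn_ne_zero _ _))] at h3

lemma single_mem (Ω : DiracSet) (f : ℕ →₀ ℕ) :
    (single (Ω, f) 1 : Fock) ∈ LinearMap.range toFock := by
  have key : ∀ (n : ℕ) (t : ℕ) (g : ℕ →₀ ℕ), (single (Ω, g) 1 : Fock) ∈ LinearMap.range toFock →
      (single (Ω, g + single t n) 1 : Fock) ∈ LinearMap.range toFock := by
    intro n t g hg
    induction n with
    | zero => simpa using hg
    | succ n ih =>
      have := boson_mem t ih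
      rwa [boson_single, add_assoc, ← single_add] at this
  induction f using Finsupp.induction with
  | zero => exact single_zero_mem Ω
  | single_add t n f _ _ ih => rw [add_comm]; exact key n t f ih

lemma toFock_surjective : Function.Surjective toFock := by
  rw [← LinearMap.range_eq_top, eq_top_iff]
  rintro v -
  induction v using Finsupp.induction_linear with
  | zero => exact Submodule.zero_mem _
  | add v w hv hw => exact Submodule.add_mem _ hv hw
  | single p c =>
    have := complex_smul_mem c (single_mem p.1 p.2)
    rwa [smul_single, smul_eq_mul, mul_one] at this

end SquareLadder

end

noncomputable section

namespace SquareLadder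

/-! ### Straightening of monomials -/

/-- Equality up to a sign. -/
def SignEq (a b : Fermion) : Prop := a = b ∨ a = -b

lemma SignEq.refl (a : Fermion) : SignEq a a := Or.inl rfl

lemma SignEq.trans {a b c : Fermion} (h : SignEq a b) (h' : SignEq b c) : SignEq a c := by
  rcases h with rfl | rfl <;> rcases h' with rfl | rfl
  · exact Or.inl rfl
  · exact Or.inr rfl
  · exact Or.inr rfl
  · exact Or.inl (neg_neg _)

lemma SignEq.mul_left {a b : Fermion} (h : SignEq a b) (c : Fermion) :
    SignEq (c * a) (c * b) := by
  rcases h with rfl | rfl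
  · exact Or.inl rfl
  · exact Or.inr (mul_neg _ _)

lemma SignEq.mul_right {a b : Fermion} (h : SignEq a b) (c : Fermion) :
    SignEq (a * c) (b * c) := by
  rcases h with rfl | rfl
  · exact Or.inl rfl
  · exact Or.inr (neg_mul _ _)

lemma SignEq.smul_mem {a b : Fermion} (h : SignEq a b) {W : Submodule ℂ Upsilon} {v : Upsilon}
    (hb : b • v ∈ W) : a • v ∈ W := by
  rcases h with rfl | rfl
  · exact hb
  · rw [neg_smul]; exact W.neg_mem hb

lemma x_mul_x (i j : ℤ) : x i * x j = -(x j * x i) :=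
  eq_neg_of_add_eq_zero_left (ExteriorAlgebra.ι_add_mul_swap _ _)

lemma x_sq (i : ℤ) : x i * x i = 0 := ExteriorAlgebra.ι_sq_zero _

lemma x_mul_y (i j : ℤ) : x i * y j = -(y j * x i) := by rw [y_mul_x, neg_neg]

lemma signEq_mul_prod {a : Fermion} {h : ℤ → Fermion} (ha : ∀ i, a * h i = -(h i * a))
    (l : List ℤ) : SignEq (a * (l.map h).prod) ((l.map h).prod * a) := by
  induction l with
  | nil => simpa using SignEq.refl a
  | cons i l ih =>
    rw [List.map_cons, List.prod_cons, ← mul_assoc, ha, neg_mul, mul_assoc, mul_assoc]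
    exact SignEq.trans (Or.inr rfl) (ih.mul_left _)

/-- Signs never matter for membership in a span or for vanishing, so the straightening works up to
sign throughout. -/
lemma signEq_of_perm {h : ℤ → Fermion} (hh : ∀ i j, h i * h j = -(h j * h i)) {l l' : List ℤ}
    (p : l.Perm l') : SignEq (l.map h).prod (l'.map h).prod := by
  induction p with
  | nil => exact SignEq.refl _
  | cons i _ ih => simpa only [List.map_cons, List.prod_cons] using ih.mul_left (h i)
  | swap i j l =>
    simp only [List.map_cons, List.prod_cons, ← mul_assoc]
    rw [hh j i, neg_mul]
    exact Or.inr rfl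
  | trans _ _ ih1 ih2 => exact ih1.trans ih2

lemma prod_eq_zero_of_not_nodup {h : ℤ → Fermion} (hh : ∀ i j, h i * h j = -(h j * h i))
    (hsq : ∀ i, h i * h i = 0) {l : List ℤ} (hl : ¬l.Nodup) : (l.map h).prod = 0 := by
  obtain ⟨i, hi⟩ := List.exists_duplicate_iff_not_nodup.2 hl
  obtain ⟨l', hl'⟩ := (List.duplicate_iff_sublist.1 hi).exists_perm_append
  have h0 : (([i, i] ++ l').map h).prod = 0 := by simp [← mul_assoc, hsq]
  rcases signEq_of_perm hh hl' with e | e <;> rw [e, h0]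
  exact neg_zero

lemma signEq_sort {h : ℤ → Fermion} (hh : ∀ i j, h i * h j = -(h j * h i)) {l : List ℤ}
    (hl : l.Nodup) : SignEq (l.map h).prod ((l.toFinset.sort (· ≤ ·)).map h).prod := by
  refine signEq_of_perm hh ?_
  rw [List.perm_ext_iff_of_nodup hl (Finset.sort_nodup _ _)]
  simp

/-- Passing a generator changes the sign twice. Hence relations that hold on γ_N can be applied
inside any monomial and on any vector a γ_N. -/
lemma xy_central (i j : ℤ) (a : Fermion) : x i * y j * a = a * (x i * y j) := by
  induction a using fermion_induction with
  | scalar c => exact (Algebra.commutes c _).symm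
  | hx k => rw [mul_assoc, y_mul_x, mul_neg, ← mul_assoc, x_mul_x, neg_mul, neg_neg, mul_assoc]
  | hy k => rw [mul_assoc, y_mul_y, mul_neg, ← mul_assoc, x_mul_y, neg_mul, neg_neg, mul_assoc]
  | mul a b ha hb => rw [← mul_assoc, ha, mul_assoc, hb, mul_assoc]
  | add a b ha hb => rw [mul_add, add_mul, ha, hb]

/-- The product `x_{i_1} ⋯ x_{i_l} y_{j_1} ⋯ y_{j_m}`. -/
def word (k l : List ℤ) : Fermion := (k.map x).prod * (l.map y).prod

lemma word_perm {k k' l l' : List ℤ} (hk : k.Perm k') (hl : l.Perm l') :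
    SignEq (word k l) (word k' l') :=
  ((signEq_of_perm x_mul_x hk).mul_right _).trans ((signEq_of_perm y_mul_y hl).mul_left _)

lemma word_cons_left (i : ℤ) (k l : List ℤ) : word (i :: k) l = x i * word k l := by
  simp [word, mul_assoc]

lemma y_mul_word (j : ℤ) (k l : List ℤ) : SignEq (y j * word k l) (word k (j :: l)) := by
  rw [word, word, List.map_cons, List.prod_cons, ← mul_assoc, ← mul_assoc]
  exact (signEq_mul_prod (fun i => y_mul_x j i) k).mul_right _

lemma SignEq.symm {a b : Fermion} (h : SignEq a b) : SignEq b a := by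
  rcases h with rfl | rfl
  · exact Or.inl rfl
  · exact Or.inr (neg_neg _).symm

lemma word_cons_cons (i j : ℤ) (k l : List ℤ) :
    SignEq (word (i :: k) (j :: l)) (x i * y j * word k l) := by
  rw [word_cons_left, mul_assoc]
  exact (y_mul_word j k l).symm.mul_left _

lemma x_mul_word (i : ℤ) (k l : List ℤ) : SignEq (x i * word k l) (word k l * x i) := by
  have h1 := (signEq_mul_prod (fun j => x_mul_x i j) k).mul_right (l.map y).prod
  have h2 := (signEq_mul_prod (fun j => x_mul_y i j) l).mul_left (k.map x).prod
  rw [mul_assoc, mul_assoc] at h1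
  exact h1.trans (by rw [word, mul_assoc]; exact h2)

lemma y_mul_word_right (i : ℤ) (k l : List ℤ) : SignEq (y i * word k l) (word k l * y i) := by
  have h1 := (signEq_mul_prod (fun j => y_mul_x i j) k).mul_right (l.map y).prod
  have h2 := (signEq_mul_prod (fun j => y_mul_y i j) l).mul_left (k.map x).prod
  rw [mul_assoc, mul_assoc] at h1
  exact h1.trans (by rw [word, mul_assoc]; exact h2)

lemma word_smul_eq_zero_of_x {k l : List ℤ} {i : ℤ} (hi : i ∈ k) {v : Upsilon}
    (hv : x i • v = 0) : word k l • v = 0 := by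
  have h : SignEq (word k l) (word (k.erase i) l * x i) :=
    (word_perm (List.perm_cons_erase hi) (List.Perm.refl l)).trans
      ((word_cons_left i _ l) ▸ x_mul_word i _ l)
  have := h.smul_mem (W := ⊥) (v := v) (by rw [mul_smul, hv, smul_zero]; exact Submodule.zero_mem _)
  exact (Submodule.mem_bot ℂ).1 this

lemma word_smul_eq_zero_of_y {k l : List ℤ} {i : ℤ} (hi : i ∈ l) {v : Upsilon}
    (hv : y i • v = 0) : word k l • v = 0 := by
  have h : SignEq (word k l) (word k (l.erase i) * y i) :=
    ((word_perm (List.Perm.refl k) (List.perm_cons_erase hi)).trans (y_mul_word i _ _).symm).trans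
      (y_mul_word_right i _ _)
  have := h.smul_mem (W := ⊥) (v := v) (by rw [mul_smul, hv, smul_zero]; exact Submodule.zero_mem _)
  exact (Submodule.mem_bot ℂ).1 this

/-! ### Rewriting close pairs by means of the relations. -/

lemma xy_smul_extreme_eq_zero {N i j : ℤ} (h : N - 1 < i ∨ N < j) :
    (x i * y j) • extreme N = 0 := by
  refine smul_extreme_eq_zero ?_
  rcases h with h | h
  · exact xy_mem_of_x h
  · exact xy_mem_of_y h

lemma relSum_mem_one (N s : ℤ) : relSum N (fun _ => 1) s ∈ annihilator N :=
  Submodule.subset_span (Or.inl (Or.inr ⟨s, rfl⟩))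

lemma relSum_mem_alternating (N s : ℤ) :
    relSum N (fun i => (-1 : ℂ) ^ i) (2 * s + 1) ∈ annihilator N :=
  Submodule.subset_span (Or.inr ⟨s, rfl⟩)

lemma relSum_smul (N : ℤ) (w : ℤ → ℂ) (s : ℤ) (v : Upsilon) :
    relSum N w s • v = ∑ i ∈ Finset.Icc (s - N) (N - 1), w i • (x i * y (s - i)) • v := by
  simp only [relSum, Finset.sum_smul, smul_assoc]

/-- For an odd index sum, adding (-1)^p times the alternating relation to the plain one doubles the
terms with i ≡ p modulo 2 and cancels the others. -/
lemma sum_same_parity_smul_extreme (N s p : ℤ) :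
    ∑ i ∈ Finset.Icc (2 * s + 1 - N) (N - 1) with 2 ∣ i - p,
      (x i * y (2 * s + 1 - i)) • extreme N = 0 := by
  have h1 := smul_extreme_eq_zero (relSum_mem_one N (2 * s + 1))
  have h2 := smul_extreme_eq_zero (relSum_mem_alternating N s)
  rw [relSum_smul] at h1 h2
  have h3 : ∑ i ∈ Finset.Icc (2 * s + 1 - N) (N - 1),
      (if 2 ∣ i - p then (2 : ℂ) • (x i * y (2 * s + 1 - i)) • extreme N else 0) = 0 := by
    have h4 := congrArg₂ (· + ·) h1 (congrArg (((-1 : ℂ) ^ p) • ·) h2)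
    simp only [smul_zero, add_zero, Finset.smul_sum, ← Finset.sum_add_distrib] at h4
    refine Eq.trans (Finset.sum_congr rfl fun i _ => ?_) h4
    rw [smul_smul, ← add_smul, ← zpow_add₀ (by norm_num : (-1 : ℂ) ≠ 0)]
    split_ifs with h
    · rw [Even.neg_one_zpow (by obtain ⟨c, hc⟩ := h; exact ⟨p + c, by omega⟩), one_add_one_eq_two]
    · rw [Odd.neg_one_zpow (by rw [← Int.not_even_iff_odd]; rintro ⟨c, hc⟩; exact h ⟨c - p, by omega⟩),
        add_neg_cancel, zero_smul]
  rw [← Finset.sum_filter, ← Finset.smul_sum] at h3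
  exact (smul_eq_zero.1 h3).resolve_left two_ne_zero

/-- A relation is solved for its term with the closest indices: the plain relation if i = j, and its
half of the parity of i if i and j are adjacent. The parity split is needed because x_i y_j and x_j
y_i both occur in the plain relation. -/
lemma exists_expansion (N i j : ℤ) (hij : |i - j| ≤ 1) : ∃ F : Finset ℤ,
    (∀ k ∈ F, 2 ≤ |k - (i + j - k)|) ∧
      (x i * y j) • extreme N = -∑ k ∈ F, (x k * y (i + j - k)) • extreme N := by
  by_cases hN : N - 1 < i ∨ N < j
  · exact ⟨∅, by simp, by rw [xy_smul_extreme_eq_zero hN]; simp⟩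
  push Not at hN
  rw [abs_le] at hij
  have hj : j = i + j - i := by ring
  have hmem : i ∈ Finset.Icc (i + j - N) (N - 1) := Finset.mem_Icc.2 ⟨by omega, by omega⟩
  by_cases he : i = j
  · refine ⟨(Finset.Icc (i + j - N) (N - 1)).erase i, fun k hk => ?_, ?_⟩
    -- Here the difference of the new indices is 2(k - i) with k ≠ i.
    · rw [le_abs]; have := Finset.ne_of_mem_erase hk; omega
    · refine eq_neg_of_add_eq_zero_left ?_
      conv_lhs => enter [1, 1, 2, 1]; rw [hj]
      rw [Finset.add_sum_erase _ (fun k => (x k * y (i + j - k)) • extreme N) hmem]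
      have := smul_extreme_eq_zero (relSum_mem_one N (i + j))
      rw [relSum_smul] at this
      simpa only [one_smul] using this
  · obtain ⟨s, hs⟩ : ∃ s, i + j = 2 * s + 1 := by
      rcases lt_or_gt_of_ne he with h | h
      · exact ⟨i, by omega⟩
      · exact ⟨j, by omega⟩
    refine ⟨((Finset.Icc (i + j - N) (N - 1)).filter (fun k => 2 ∣ k - i)).erase i, fun k hk => ?_, ?_⟩
    -- The difference of the new indices is 2(k - i) + (i - j) with k - i even and nonzero, so it
    -- cannot be ±1.
    · rw [le_abs]
      have h1 := Finset.ne_of_mem_erase hk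
      obtain ⟨c, hc⟩ := (Finset.mem_filter.1 (Finset.mem_of_mem_erase hk)).2
      omega
    · refine eq_neg_of_add_eq_zero_left ?_
      conv_lhs => enter [1, 1, 2, 1]; rw [hj]
      rw [Finset.add_sum_erase _ (fun k => (x k * y (i + j - k)) • extreme N)
        (Finset.mem_filter.2 ⟨hmem, by simp⟩), hs]
      exact sum_same_parity_smul_extreme N s i

/-- The conditions on the indices of the monomials that form a basis of `Υ(N)`. -/
def Admissible (N : ℤ) (A B : Finset ℤ) : Prop :=
  (∀ i ∈ A, i ≤ N - 1) ∧ (∀ j ∈ B, j ≤ N) ∧ ∀ i ∈ A, ∀ j ∈ B, 2 ≤ |i - j|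

/-- The span of the admissible monomials. -/
def admissibleSpan (N : ℤ) : Submodule ℂ Upsilon :=
  Submodule.span ℂ {v | ∃ A B, Admissible N A B ∧ v = monomial A B • extreme N}

/-- The bound behind termination: once no index exceeds N, the measure (∑ a)² - ∑ a² with a = N -
index is nonnegative. -/
lemma sum_sq_le (N : ℤ) (l : List ℤ) (hl : ∀ i ∈ l, i ≤ N) :
    0 ≤ (l.map (N - ·)).sum ∧ (l.map (fun i => (N - i) ^ 2)).sum ≤ (l.map (N - ·)).sum ^ 2 := by
  induction l with
  | nil => simp
  | cons i l ih =>
    obtain ⟨h1, h2⟩ := ih fun j hj => hl j (List.mem_cons_of_mem _ hj)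
    have h3 : 0 ≤ N - i := sub_nonneg.2 (hl i List.mem_cons_self)
    simp only [List.map_cons, List.sum_cons]
    exact ⟨by omega, by nlinarith [mul_nonneg h3 h1]⟩

lemma word_smul_extreme_mem_aux (N : ℤ) (n : ℕ) (k l : List ℤ)
    (hn : ((k ++ l).map (N - ·)).sum ^ 2 - ((k ++ l).map (fun i => (N - i) ^ 2)).sum < n) :
    word k l • extreme N ∈ admissibleSpan N := by
  induction n generalizing k l with
  | zero =>
    by_cases hk : ∃ i ∈ k, N - 1 < i
    · obtain ⟨i, hi, h⟩ := hk
      rw [word_smul_eq_zero_of_x hi (smul_extreme_eq_zero (x_mem h))]; exact Submodule.zero_mem _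
    by_cases hl : ∃ j ∈ l, N < j
    · obtain ⟨j, hj, h⟩ := hl
      rw [word_smul_eq_zero_of_y hj (smul_extreme_eq_zero (y_mem h))]; exact Submodule.zero_mem _
    push Not at hk hl
    have := (sum_sq_le N (k ++ l) (fun i hi => (List.mem_append.1 hi).elim
      (fun h => by have := hk i h; omega) (hl i))).2
    push_cast at hn
    omega
  | succ n ih =>
    by_cases hk : ∃ i ∈ k, N - 1 < i
    · obtain ⟨i, hi, h⟩ := hk
      rw [word_smul_eq_zero_of_x hi (smul_extreme_eq_zero (x_mem h))]; exact Submodule.zero_mem _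
    by_cases hl : ∃ j ∈ l, N < j
    · obtain ⟨j, hj, h⟩ := hl
      rw [word_smul_eq_zero_of_y hj (smul_extreme_eq_zero (y_mem h))]; exact Submodule.zero_mem _
    push Not at hk hl
    by_cases hkn : k.Nodup
    swap
    · rw [word, prod_eq_zero_of_not_nodup x_mul_x x_sq hkn, zero_mul, zero_smul]
      exact Submodule.zero_mem _
    by_cases hln : l.Nodup
    swap
    · rw [word, prod_eq_zero_of_not_nodup y_mul_y y_sq hln, mul_zero, zero_smul]
      exact Submodule.zero_mem _
    by_cases had : ∀ i ∈ k, ∀ j ∈ l, 2 ≤ |i - j|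
    · refine (((signEq_sort x_mul_x hkn).mul_right _).trans
        ((signEq_sort y_mul_y hln).mul_left _)).smul_mem (Submodule.subset_span
          ⟨k.toFinset, l.toFinset, ⟨?_, ?_, ?_⟩, rfl⟩)
      · simpa using hk
      · simpa using hl
      · simpa using had
    push Not at had
    obtain ⟨i, hi, j, hj, hij⟩ := had
    have pk := List.perm_cons_erase hi
    have pl := List.perm_cons_erase hj
    refine ((word_perm pk pl).trans (word_cons_cons _ _ _ _)).smul_mem ?_
    have pe := (pk.append pl)
    rw [(pe.map (N - ·)).sum_eq, (pe.map (fun i => (N - i) ^ 2)).sum_eq] at hn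
    obtain ⟨F, hF, e⟩ := exists_expansion N i j (by omega)
    -- The close pair is central, so it is moved next to γ_N, expanded there, and moved back.
    rw [xy_central, mul_smul, e, smul_neg, Finset.smul_sum]
    refine Submodule.neg_mem _ (Submodule.sum_mem _ fun m hm => ?_)
    rw [← mul_smul, ← xy_central]
    refine (word_cons_cons _ _ _ _).symm.smul_mem (ih _ _ ?_)
    have h2 := hF m hm
    -- With the sum of two indices fixed, the sum of their squares grows with the square of their
    -- difference, here from at most 1 to at least 4. So the measure strictly drops.
    have e1 : (m - (i + j - m)) ^ 2 ≥ 4 := by nlinarith [sq_abs (m - (i + j - m))]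
    have e2 : (i - j) ^ 2 ≤ 1 := by nlinarith [sq_abs (i - j), abs_nonneg (i - j)]
    simp only [List.cons_append, List.map_cons, List.sum_cons, List.map_append, List.sum_append]
      at hn ⊢
    push_cast at hn
    generalize (List.map (fun x => N - x) (k.erase i)).sum = a1 at *
    generalize (List.map (fun x => N - x) (l.erase j)).sum = a2 at *
    have e3 : N - m + (a1 + (N - (i + j - m) + a2)) = N - i + (a1 + (N - j + a2)) := by ring
    rw [e3]
    generalize (N - i + (a1 + (N - j + a2))) ^ 2 = a3 at *
    nlinarith

lemma word_smul_extreme_mem (N : ℤ) (k l : List ℤ) :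
    word k l • extreme N ∈ admissibleSpan N :=
  word_smul_extreme_mem_aux N ((((k ++ l).map (N - ·)).sum ^ 2 -
    ((k ++ l).map (fun i => (N - i) ^ 2)).sum).toNat + 1) k l (by push_cast; omega)

lemma fermion_smul_comm (a : Fermion) (c : ℂ) (v : Upsilon) : a • c • v = c • a • v := by
  rw [← algebraMap_smul Fermion c v, ← algebraMap_smul Fermion c (a • v), ← mul_smul, ← mul_smul,
    Algebra.commutes]

lemma smul_mem_span_words {N : ℤ} (a : Fermion) {v : Upsilon}
    (hv : v ∈ Submodule.span ℂ (Set.range fun p : List ℤ × List ℤ => word p.1 p.2 • extreme N)) :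
    a • v ∈ Submodule.span ℂ (Set.range fun p : List ℤ × List ℤ => word p.1 p.2 • extreme N) := by
  induction a using fermion_induction generalizing v with
  | scalar c => rw [algebraMap_smul]; exact Submodule.smul_mem _ _ hv
  | hx i =>
    induction hv using Submodule.span_induction with
    | mem v h =>
      obtain ⟨p, rfl⟩ := h
      refine Submodule.subset_span ⟨(i :: p.1, p.2), ?_⟩
      simp only [word_cons_left, mul_smul]
    | zero => rw [smul_zero]; exact Submodule.zero_mem _
    | add v w _ _ hv hw => rw [smul_add]; exact Submodule.add_mem _ hv hw
    | smul c v _ hv => rw [fermion_smul_comm]; exact Submodule.smul_mem _ _ hv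
  | hy i =>
    induction hv using Submodule.span_induction with
    | mem v h =>
      obtain ⟨p, rfl⟩ := h
      rw [← mul_smul]
      exact (y_mul_word i p.1 p.2).smul_mem (Submodule.subset_span ⟨(p.1, i :: p.2), rfl⟩)
    | zero => rw [smul_zero]; exact Submodule.zero_mem _
    | add v w _ _ hv hw => rw [smul_add]; exact Submodule.add_mem _ hv hw
    | smul c v _ hv => rw [fermion_smul_comm]; exact Submodule.smul_mem _ _ hv
  | mul a b ha hb => rw [mul_smul]; exact ha (hb hv)
  | add a b ha hb => rw [add_smul]; exact Submodule.add_mem _ (ha hv) (hb hv)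

lemma smul_extreme_mem (N : ℤ) (a : Fermion) : a • extreme N ∈ admissibleSpan N := by
  have h := smul_mem_span_words (N := N) a (v := extreme N)
    (Submodule.subset_span ⟨([], []), by simp [word]⟩)
  refine Submodule.span_le.2 ?_ h
  rintro _ ⟨p, rfl⟩
  exact word_smul_extreme_mem N p.1 p.2

/-! ### The relations on `Υ` -/

/-- Centrality of x_i y_j reduces the claim on a γ_N to γ_N itself, where `relSum` keeps every term
that can be nonzero. -/
lemma relation_on_upsilon (w : ℤ → ℂ) (s : ℤ) (h : ∀ N, relSum N w s ∈ annihilator N)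
    (v : Upsilon) : {i : ℤ | (x i * y (s - i)) • v ≠ 0}.Finite ∧
      ∑ᶠ i : ℤ, w i • (x i * y (s - i)) • v = 0 := by
  obtain ⟨N, a, rfl⟩ := exists_smul_extreme v
  have hz : ∀ i ∉ Finset.Icc (s - N) (N - 1), (x i * y (s - i)) • a • extreme N = 0 := by
    intro i hi
    rw [Finset.mem_Icc] at hi
    rw [← mul_smul, xy_central, mul_smul, xy_smul_extreme_eq_zero (by omega), smul_zero]
  constructor
  · refine (Finset.finite_toSet (Finset.Icc (s - N) (N - 1))).subset fun i hi => ?_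
    by_contra hc
    exact hi (hz i hc)
  · rw [finsum_eq_sum_of_support_subset (s := Finset.Icc (s - N) (N - 1))]
    · have h1 := smul_extreme_eq_zero (h N)
      rw [relSum_smul] at h1
      have h2 := congrArg (a • ·) h1
      simp only [smul_zero, Finset.smul_sum] at h2
      refine Eq.trans (Finset.sum_congr rfl fun i _ => ?_) h2
      rw [fermion_smul_comm, ← mul_smul, ← mul_smul, xy_central]
    · intro i hi
      by_contra hc
      exact hi (by simp only [hz i hc, smul_zero])

lemma relationsHold : RelationsHold := by
  intro s v
  obtain ⟨h1, h2⟩ := relation_on_upsilon (fun _ => 1) s (fun N => relSum_mem_one N s) v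
  obtain ⟨-, h3⟩ := relation_on_upsilon (fun i => (-1 : ℂ) ^ i) (2 * s + 1)
    (fun N => relSum_mem_alternating N s) v
  have e1 : ∀ i : ℤ, -i + s = s - i := fun i => by ring
  have e2 : ∀ i : ℤ, -i + 2 * s + 1 = 2 * s + 1 - i := fun i => by ring
  simp only [e1, e2]
  exact ⟨h1, by simpa only [one_smul] using h2, h3⟩

end SquareLadder

end

noncomputable section

namespace SquareLadder

/-! ### Configurations -/

namespace Config

variable {r : Row}

/-- The set of occupied columns. -/
def columns (S : Config r) : Set ℤ := Prod.fst '' S.carrier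

lemma ext_carrier {S T : Config r} (h : S.carrier = T.carrier) : S = T := by
  cases S; cases T; cases h; rfl

lemma isDirac_columns (S : Config r) : IsDirac S.columns := S.dirac

lemma mem_columns_of_mem {S : Config r} {k : ℤ} {s : Row} (h : (k, s) ∈ S.carrier) :
    k ∈ S.columns := ⟨_, h, rfl⟩

lemma mem_columns {S : Config r} {k : ℤ} : k ∈ S.columns ↔ ∃ s, (k, s) ∈ S.carrier :=
  ⟨fun ⟨⟨_, s⟩, h, e⟩ => ⟨s, e ▸ h⟩, fun ⟨_, h⟩ => mem_columns_of_mem h⟩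

lemma row_eq {S : Config r} {k l : ℤ} {s t : Row} (hs : (k, s) ∈ S.carrier)
    (ht : (l, t) ∈ S.carrier) (h : |k - l| ≤ 1) : s = t := by
  by_contra hst
  exact S.indep hs ht (fun e => hst (congrArg Prod.snd e)) ⟨hst, h⟩

/-- Particles in adjacent columns cannot stand in different rows, so the row of the tail propagates
to the right until the first empty column. -/
lemma mem_of_forall_occupied {S : Config r} {K : ℤ} (h : ∀ k < K, k ∈ S.columns) :
    ∀ k < K, (k, r) ∈ S.carrier := by
  obtain ⟨M, hM⟩ := S.tail
  intro k hk
  rcases le_or_gt k M with h0 | h0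
  · exact hM k h0
  · induction k, h0.le using Int.leInduction with
    | base => exact hM M le_rfl
    | succ k hk' ih =>
      have h1 : (k, r) ∈ S.carrier := by
        rcases hk'.eq_or_lt with rfl | h2
        · exact hM _ le_rfl
        · exact ih (by omega) h2
      obtain ⟨s, hs⟩ := mem_columns.1 (h (k + 1) hk)
      have := row_eq h1 hs (by rw [abs_le]; omega)
      exact this ▸ hs

end Config

/-! ### Finiteness of the sets of configurations. -/

lemma abs_le_diracEnergy {Ω : Set ℤ} (h : IsDirac Ω) {k : ℤ} (hk : k ∈ diracE Ω ∪ diracP Ω) :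
    |k| ≤ diracEnergy Ω := by
  have hf := h.1.union h.2
  rw [diracEnergy, finsum_mem_eq_finite_toFinset_sum _ hf]
  exact Finset.single_le_sum (f := fun k : ℤ => |k|) (fun j _ => abs_nonneg j)
    (hf.mem_toFinset.2 hk)

lemma configsOf_finite (r : Row) (n m : ℤ) : (configsOf r n m).Finite := by
  have key : ∀ S ∈ configsOf r n m, (∀ k < -m, (k, r) ∈ S.carrier) ∧
      ∀ k, m < k → k ∉ S.columns := by
    intro S hS
    have hm : diracEnergy S.columns = m := hS.2
    have h0 : 0 ≤ m := hm ▸ finsum_mem_induction (0 ≤ ·) le_rfl (fun _ _ => add_nonneg)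
      (fun k _ => abs_nonneg k)
    refine ⟨Config.mem_of_forall_occupied fun k hk => ?_, fun k hk hc => ?_⟩
    · by_contra hc
      have := abs_le_diracEnergy S.isDirac_columns
        (Or.inr ⟨show k < 0 by omega, hc⟩ : k ∈ diracE S.columns ∪ diracP S.columns)
      rw [hm, abs_le] at this
      omega
    · have := abs_le_diracEnergy S.isDirac_columns
        (Or.inl ⟨hc, show 0 ≤ k by omega⟩ : k ∈ diracE S.columns ∪ diracP S.columns)
      rw [hm, abs_le] at this
      omega
  have huniv : (Set.univ : Set Row).Finite :=
    (Set.toFinite {Row.upper, Row.lower}).subset fun s _ => by cases s <;> simp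
  have hbox : ((Set.Icc (-m) m) ×ˢ (Set.univ : Set Row)).Finite :=
    (Set.finite_Icc _ _).prod huniv
  -- With energy m, everything left of -m is filled in the row of the tail and everything right of m
  -- is empty. The configuration is thus determined by its part in the columns from -m to m.
  refine Set.Finite.of_finite_image (f := fun S : Config r =>
    S.carrier ∩ (Set.Icc (-m) m) ×ˢ (Set.univ : Set Row))
    (hbox.finite_subsets.subset ?_) ?_
  · rintro _ ⟨S, -, rfl⟩
    exact Set.inter_subset_right
  · have sub : ∀ S ∈ configsOf r n m, ∀ T ∈ configsOf r n m,
        S.carrier ∩ (Set.Icc (-m) m) ×ˢ (Set.univ : Set Row) =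
          T.carrier ∩ (Set.Icc (-m) m) ×ˢ (Set.univ : Set Row) → S.carrier ⊆ T.carrier := by
      rintro S hS T hT e ⟨k, s⟩ hks
      rcases lt_or_ge k (-m) with h | h
      · rw [Config.row_eq hks ((key S hS).1 k h) (by simp)]
        exact (key T hT).1 k h
      · have hkm : k ≤ m := not_lt.1 fun hc => (key S hS).2 k hc (Config.mem_columns_of_mem hks)
        have h1 : (k, s) ∈ S.carrier ∩ (Set.Icc (-m) m) ×ˢ (Set.univ : Set Row) :=
          ⟨hks, ⟨h, hkm⟩, trivial⟩
        rw [e] at h1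
        exact h1.1
    intro S hS T hT e
    exact Config.ext_carrier (Set.Subset.antisymm (sub S hS T hT e) (sub T hT S hS e.symm))

/-! ### The symmetry between the two rows. -/

/-- The other row. -/
def Row.flip : Row → Row
  | Row.upper => Row.lower
  | Row.lower => Row.upper

lemma Row.flip_flip (r : Row) : r.flip.flip = r := by cases r <;> rfl

lemma Row.flip_injective : Function.Injective Row.flip := fun r s h => by
  rw [← r.flip_flip, h, s.flip_flip]

/-- The configuration with the rows interchanged. -/
def Config.flip {r : Row} (S : Config r) : Config r.flip where
  carrier := {v | (v.1, v.2.flip) ∈ S.carrier}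
  indep := by
    intro v hv w hw hvw hadj
    refine S.indep hv hw (fun e => hvw ?_) ⟨fun e => hadj.1 (Row.flip_injective e), hadj.2⟩
    exact Prod.ext (Prod.mk.inj e).1 (Row.flip_injective (Prod.mk.inj e).2)
  dirac := by
    convert S.dirac using 1
    ext k
    constructor
    · rintro ⟨v, hv, rfl⟩
      exact ⟨_, hv, rfl⟩
    · rintro ⟨⟨j, s⟩, hv, rfl⟩
      refine ⟨(j, s.flip), ?_, rfl⟩
      change (j, s.flip.flip) ∈ S.carrier
      rwa [Row.flip_flip]
  tail := by
    obtain ⟨M, hM⟩ := S.tail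
    refine ⟨M, fun k hk => ?_⟩
    change (k, r.flip.flip) ∈ S.carrier
    rw [Row.flip_flip]
    exact hM k hk

lemma Config.mem_flip {r : Row} {S : Config r} {k : ℤ} {s : Row} :
    (k, s) ∈ S.flip.carrier ↔ (k, s.flip) ∈ S.carrier := Iff.rfl

lemma Config.columns_flip {r : Row} (S : Config r) : S.flip.columns = S.columns := by
  ext k
  rw [Config.mem_columns, Config.mem_columns]
  constructor
  · rintro ⟨s, hs⟩; exact ⟨_, hs⟩
  · rintro ⟨s, hs⟩; exact ⟨s.flip, by rwa [Config.mem_flip, Row.flip_flip]⟩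

lemma Config.flip_injective {r : Row} :
    Function.Injective (Config.flip : Config r → Config r.flip) := by
  intro S T h
  refine Config.ext_carrier (Set.ext fun ⟨k, s⟩ => ?_)
  have h1 := @Config.mem_flip r S k s.flip
  rw [h, Config.mem_flip, Row.flip_flip] at h1
  exact h1.symm

lemma statSum_le_flip (r : Row) (n m : ℤ) : statSum r n m ≤ statSum r.flip n m := by
  refine Set.ncard_le_ncard_of_injOn Config.flip (fun S hS => ?_) Config.flip_injective.injOn
    (configsOf_finite _ n m)
  have h := S.columns_flip
  exact ⟨(congrArg diracCharge h).trans hS.1, (congrArg diracEnergy h).trans hS.2⟩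

lemma statSum_eq_lower (r : Row) (n m : ℤ) : statSum r n m = statSum Row.lower n m := by
  cases r
  · exact le_antisymm (statSum_le_flip Row.upper n m) (statSum_le_flip Row.lower n m)
  · rfl

/-! ### Domain walls -/

/-- The number of elements of `Ω` that are at least `k`. -/
def rank (Ω : Set ℤ) (k : ℤ) : ℕ := {j | j ∈ Ω ∧ k ≤ j}.ncard

lemma rank_lt_of_lt {Ω : Set ℤ} (h : IsDirac Ω) {k l : ℤ} (hk : k ∈ Ω) (hkl : k < l) :
    rank Ω l < rank Ω k := by
  refine Set.ncard_lt_ncard ⟨fun j hj => ⟨hj.1, hkl.le.trans hj.2⟩, fun hs => ?_⟩ (h.finite_ge k)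
  exact absurd (hs (⟨hk, le_rfl⟩ : k ∈ {j | j ∈ Ω ∧ k ≤ j})).2 (not_le.2 hkl)

lemma rank_le_rank_iff {Ω : Set ℤ} (h : IsDirac Ω) {k l : ℤ} (hk : k ∈ Ω) (hl : l ∈ Ω) :
    rank Ω l ≤ rank Ω k ↔ k ≤ l := by
  constructor
  · intro hr
    by_contra hc
    exact absurd (rank_lt_of_lt h hl (not_le.1 hc)) (not_lt.2 hr)
  · intro hkl
    rcases hkl.eq_or_lt with rfl | hlt
    · exact le_rfl
    · exact (rank_lt_of_lt h hk hlt).le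

lemma rank_inj {Ω : Set ℤ} (h : IsDirac Ω) {k l : ℤ} (hk : k ∈ Ω) (hl : l ∈ Ω)
    (e : rank Ω k = rank Ω l) : k = l :=
  le_antisymm ((rank_le_rank_iff h hk hl).1 e.ge) ((rank_le_rank_iff h hl hk).1 e.le)

lemma rank_pos {Ω : Set ℤ} (h : IsDirac Ω) {k : ℤ} (hk : k ∈ Ω) : 0 < rank Ω k :=
  (Set.ncard_pos (h.finite_ge k)).2 ⟨k, hk, le_rfl⟩

/-- A Dirac set together with a finite set of walls: a wall is a particle whose left neighbour
stands in the other row, so that the column to the left of a wall is empty. -/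
structure IsWalled (Ω : Set ℤ) (D : Finset ℤ) : Prop where
  dirac : IsDirac Ω
  subset : ∀ d ∈ D, d ∈ Ω
  gap : ∀ d ∈ D, d - 1 ∉ Ω

/-- The number of walls that are not to the right of `k`. -/
def wallCount (D : Finset ℤ) (k : ℤ) : ℕ := (D.filter (· ≤ k)).card

/-- The column of the particle after the removal of the walls. -/
def shift (D : Finset ℤ) (k : ℤ) : ℤ := k - wallCount D k

namespace IsWalled

variable {Ω : Set ℤ} {D : Finset ℤ}

/-- If d is a wall with k < d ≤ l, then d - 1 is empty, hence differs from k and lies strictly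
between k and l. So fewer than l - k walls are passed. -/
lemma shift_lt (h : IsWalled Ω D) {k l : ℤ} (hk : k ∈ Ω) (hkl : k < l) :
    shift D k < shift D l := by
  have h1 : wallCount D l ≤ wallCount D k + (Finset.Ioo k l).card := by
    have h2 : D.filter (· ≤ l) ⊆ D.filter (· ≤ k) ∪ (Finset.Ioo k l).image (· + 1) := by
      intro d hd
      rw [Finset.mem_filter] at hd
      rw [Finset.mem_union, Finset.mem_filter, Finset.mem_image]
      by_cases hdk : d ≤ k
      · exact Or.inl ⟨hd.1, hdk⟩
      · refine Or.inr ⟨d - 1, Finset.mem_Ioo.2 ⟨?_, by omega⟩, by ring⟩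
        have := h.gap d hd.1
        have hne : d - 1 ≠ k := fun e => this (e ▸ hk)
        omega
    exact (Finset.card_le_card h2).trans ((Finset.card_union_le _ _).trans
      (Nat.add_le_add_left Finset.card_image_le _))
  rw [Int.card_Ioo] at h1
  simp only [shift]
  omega

lemma shift_injOn (h : IsWalled Ω D) : Set.InjOn (shift D) Ω := by
  intro k hk l hl e
  rcases lt_trichotomy k l with hlt | he | hlt
  · exact absurd e (h.shift_lt hk hlt).ne
  · exact he
  · exact absurd e (h.shift_lt hl hlt).ne'

lemma shift_le_iff (h : IsWalled Ω D) {k l : ℤ} (hk : k ∈ Ω) (hl : l ∈ Ω) :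
    shift D k ≤ shift D l ↔ k ≤ l := by
  constructor
  · intro hr
    by_contra hc
    exact absurd (h.shift_lt hl (not_le.1 hc)) (not_lt.2 hr)
  · intro hkl
    rcases hkl.eq_or_lt with rfl | hlt
    · exact le_rfl
    · exact (h.shift_lt hk hlt).le

lemma rank_shift (h : IsWalled Ω D) {k : ℤ} (hk : k ∈ Ω) :
    rank (shift D '' Ω) (shift D k) = rank Ω k := by
  have e : {j | j ∈ shift D '' Ω ∧ shift D k ≤ j} = shift D '' {j | j ∈ Ω ∧ k ≤ j} := by
    ext j
    constructor
    · rintro ⟨⟨l, hl, rfl⟩, h2⟩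
      exact ⟨l, ⟨hl, (h.shift_le_iff hk hl).1 h2⟩, rfl⟩
    · rintro ⟨l, ⟨hl, h2⟩, rfl⟩
      exact ⟨⟨l, hl, rfl⟩, (h.shift_le_iff hk hl).2 h2⟩
  rw [rank, e, Set.InjOn.ncard_image (h.shift_injOn.mono fun j hj => hj.1), rank]

lemma rank_injOn (h : IsWalled Ω D) : Set.InjOn (rank Ω) D := fun _ hk _ hl e =>
  rank_inj h.dirac (h.subset _ hk) (h.subset _ hl) e

/-- Ranks reverse the order of particles, so the walls weakly to the left of k can be counted from
the ranks alone. -/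
lemma wallCount_eq (h : IsWalled Ω D) {k : ℤ} (hk : k ∈ Ω) :
    wallCount D k = ((D.image (rank Ω)).filter (rank Ω k ≤ ·)).card := by
  rw [Finset.filter_image, Finset.card_image_of_injOn
    (h.rank_injOn.mono fun d hd => (Finset.mem_filter.1 hd).1), wallCount]
  congr 1
  refine Finset.filter_congr fun d hd => ?_
  rw [rank_le_rank_iff h.dirac (h.subset d hd) hk]

lemma mem_iff_rank_mem (h : IsWalled Ω D) {k : ℤ} (hk : k ∈ Ω) :
    k ∈ D ↔ rank Ω k ∈ D.image (rank Ω) := by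
  refine ⟨fun hd => Finset.mem_image_of_mem _ hd, fun hr => ?_⟩
  obtain ⟨d, hd, e⟩ := Finset.mem_image.1 hr
  exact rank_inj h.dirac (h.subset d hd) hk e ▸ hd

/-- The shift keeps ranks, and the rank of a particle tells how many walls precede it; adding that
number to the shifted column recovers the original one. -/
lemma subset_of_shift_eq {Ω' : Set ℤ} {D' : Finset ℤ} (h : IsWalled Ω D) (h' : IsWalled Ω' D')
    (e1 : shift D '' Ω = shift D' '' Ω') (e2 : D.image (rank Ω) = D'.image (rank Ω')) :
    Ω ⊆ Ω' := by
  intro k hk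
  obtain ⟨l, hl, e⟩ : shift D k ∈ shift D' '' Ω' := e1 ▸ Set.mem_image_of_mem _ hk
  have hr : rank Ω k = rank Ω' l := by
    rw [← h.rank_shift hk, ← h'.rank_shift hl, e, e1]
  have hw : wallCount D k = wallCount D' l := by
    rw [h.wallCount_eq hk, h'.wallCount_eq hl, hr, e2]
  have : k = l := by
    simp only [shift] at e
    omega
  exact this ▸ hl

lemma eq_of_shift_eq {Ω' : Set ℤ} {D' : Finset ℤ} (h : IsWalled Ω D) (h' : IsWalled Ω' D')
    (e1 : shift D '' Ω = shift D' '' Ω') (e2 : D.image (rank Ω) = D'.image (rank Ω')) :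
    Ω = Ω' ∧ D = D' := by
  have e : Ω = Ω' := Set.Subset.antisymm (h.subset_of_shift_eq h' e1 e2)
    (h'.subset_of_shift_eq h e1.symm e2.symm)
  subst e
  refine ⟨rfl, Finset.ext fun d => ⟨fun hd => ?_, fun hd => ?_⟩⟩
  · rw [h'.mem_iff_rank_mem (h.subset d hd), ← e2]; exact Finset.mem_image_of_mem _ hd
  · rw [h.mem_iff_rank_mem (h'.subset d hd), e2]; exact Finset.mem_image_of_mem _ hd

/-- Each wall d moves every particle at or to the right of d one column to the left, which lowers
the energy by the rank of d. Far to the left nothing moves, so charge and energy are compared on the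
finite part above M. -/
lemma shift_image (h : IsWalled Ω D) : IsDirac (shift D '' Ω) ∧
    diracCharge (shift D '' Ω) = diracCharge Ω ∧
    diracEnergy (shift D '' Ω) + ∑ j ∈ D.image (rank Ω), (j : ℤ) = diracEnergy Ω := by
  obtain ⟨M, hM⟩ := h.dirac.exists_iio_subset
  have hD : ∀ d ∈ D, M ≤ d := fun d hd => not_lt.1 fun hc => h.gap d hd (hM (by
    rw [Set.mem_Iio]; omega))
  have hlow : ∀ k < M, shift D k = k := fun k hk => by
    have : D.filter (· ≤ k) = ∅ := Finset.filter_eq_empty_iff.2 fun d hd => by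
      have := hD d hd; omega
    rw [shift, wallCount, this]; simp
  set T := (h.dirac.finite_ge M).toFinset with hT
  have memT : ∀ k, k ∈ T ↔ k ∈ Ω ∧ M ≤ k := fun k => by rw [hT]; simp
  have hhigh : ∀ k ∈ T.image (shift D), M ≤ k := by
    intro k hk
    obtain ⟨l, hl, rfl⟩ := Finset.mem_image.1 hk
    have h1 := h.shift_lt (hM (show M - 1 < M by omega)) (show M - 1 < l by
      have := ((memT l).1 hl).2; omega)
    rw [hlow _ (by omega)] at h1
    omega
  have himg : shift D '' Ω = Set.Iio M ∪ ((T.image (shift D) : Finset ℤ) : Set ℤ) := by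
    rw [h.dirac.eq_union hM, Set.image_union, Finset.coe_image]
    congr 1
    ext k
    constructor
    · rintro ⟨l, hl, rfl⟩; rw [hlow l hl]; exact hl
    · intro hk; exact ⟨k, hk, hlow k hk⟩
  have hinj : Set.InjOn (shift D) T := h.shift_injOn.mono fun k hk => ((memT k).1 hk).1
  obtain ⟨c1, c2, c3⟩ := iio_union_finset M _ hhigh
  obtain ⟨d2, d3⟩ := h.dirac.charge_energy hM
  rw [← himg] at c1 c2 c3
  refine ⟨c1, ?_, ?_⟩
  · rw [c2, d2, Finset.card_image_of_injOn hinj]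
  · rw [← hT] at d3
    rw [Finset.sum_image hinj] at c3
    rw [Finset.sum_image h.rank_injOn]
    -- Double counting of the pairs of a wall d and a particle k with d ≤ k.
    have hcount : ∑ k ∈ T, (wallCount D k : ℤ) = ∑ d ∈ D, (rank Ω d : ℤ) := by
      have h1 := Finset.sum_card_bipartiteAbove_eq_sum_card_bipartiteBelow (s := D) (t := T)
        (fun d k => d ≤ k)
      have h2 : ∀ d ∈ D, (Finset.bipartiteAbove (fun d k => d ≤ k) T d).card = rank Ω d := by
        intro d hd
        rw [rank, ← Set.ncard_coe_finset]
        congr 1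
        ext k
        simp only [Finset.bipartiteAbove, Finset.coe_filter, Set.mem_ofPred_eq, memT]
        have := hD d hd
        constructor
        · rintro ⟨⟨a, -⟩, b⟩; exact ⟨a, b⟩
        · rintro ⟨a, b⟩; exact ⟨⟨a, by omega⟩, b⟩
      rw [Finset.sum_congr rfl h2] at h1
      rw [← Nat.cast_sum, ← Nat.cast_sum, h1]
      rfl
    have hs : ∑ k ∈ T, shift D k = ∑ k ∈ T, k - ∑ d ∈ D, (rank Ω d : ℤ) := by
      rw [← hcount, ← Finset.sum_sub_distrib]; rfl
    rw [hs] at c3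
    linarith

end IsWalled

namespace Config

/-- The walls of a configuration. -/
def wallSet (S : Config Row.lower) : Set ℤ :=
  {d | ∃ (k : ℤ) (s t : Row), k < d ∧ s ≠ t ∧ (d, s) ∈ S.carrier ∧ (k, t) ∈ S.carrier ∧
    ∀ j, k < j → j < d → j ∉ S.columns}

lemma wallSet_finite (S : Config Row.lower) : S.wallSet.Finite := by
  obtain ⟨M, hM⟩ := S.tail
  refine (S.isDirac_columns.finite_ge M).subset ?_
  rintro d ⟨k, s, t, hkd, hst, hs, ht, -⟩
  refine ⟨mem_columns_of_mem hs, ?_⟩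
  by_contra hc
  have h1 := row_eq hs (hM d (by omega)) (by simp)
  have h2 := row_eq ht (hM k (by omega)) (by simp)
  exact hst (h1.trans h2.symm)

/-- The walls of a configuration, as a finite set. -/
def walls (S : Config Row.lower) : Finset ℤ := S.wallSet_finite.toFinset

lemma mem_walls {S : Config Row.lower} {d : ℤ} : d ∈ S.walls ↔ d ∈ S.wallSet :=
  Set.Finite.mem_toFinset _

lemma isWalled (S : Config Row.lower) : IsWalled S.columns S.walls where
  dirac := S.isDirac_columns
  subset d hd := by
    obtain ⟨k, s, t, -, -, hs, -⟩ := mem_walls.1 hd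
    exact mem_columns_of_mem hs
  gap d hd hc := by
    obtain ⟨k, s, t, hkd, hst, hs, ht, hgap⟩ := mem_walls.1 hd
    rcases (show k ≤ d - 1 by omega).eq_or_lt with e | hlt
    · exact hst (row_eq hs ht (by rw [e, abs_le]; omega))
    · exact hgap _ hlt (by omega) hc

lemma exists_pred {S : Config Row.lower} {M : ℤ} (hM : ∀ k ≤ M, (k, Row.lower) ∈ S.carrier)
    {k : ℤ} (hk : M < k) :
    ∃ p, M ≤ p ∧ p < k ∧ p ∈ S.columns ∧ ∀ j, p < j → j < k → j ∉ S.columns := by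
  have hex : ∃ p, p < k ∧ p ∈ S.columns := ⟨M, hk, mem_columns_of_mem (hM M le_rfl)⟩
  obtain ⟨p, ⟨h1, h2⟩, h3⟩ := Int.exists_greatest_of_bdd (P := fun p => p < k ∧ p ∈ S.columns)
    ⟨k, fun z hz => hz.1.le⟩ hex
  refine ⟨p, h3 M ⟨hk, mem_columns_of_mem (hM M le_rfl)⟩, h1, h2, fun j hj hjk hc => ?_⟩
  have := h3 j ⟨hjk, hc⟩
  omega

/-- Reading from the tail to the right, the row changes exactly at the walls. The induction passes
from a particle to its nearest occupied column on the left. -/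
lemma lower_iff_even {S : Config Row.lower} {k : ℤ} {s : Row} (hk : (k, s) ∈ S.carrier) :
    s = Row.lower ↔ Even (wallCount S.walls k) := by
  obtain ⟨M, hM⟩ := S.tail
  have hlow : ∀ d ∈ S.walls, M < d := by
    intro d hd
    by_contra hc
    exact S.isWalled.gap d hd (mem_columns_of_mem (hM (d - 1) (by omega)))
  obtain ⟨n, hn⟩ : ∃ n : ℕ, k ≤ M + n := ⟨(k - M).toNat, by omega⟩
  induction n using Nat.strong_induction_on generalizing k s with
  | _ n ih =>
    rcases le_or_gt k M with h0 | h0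
    · have h1 : s = Row.lower := row_eq hk (hM k h0) (by simp)
      have h2 : wallCount S.walls k = 0 := by
        rw [wallCount, Finset.card_eq_zero, Finset.filter_eq_empty_iff]
        intro d hd; have := hlow d hd; omega
      simp [h1, h2]
    · obtain ⟨p, hMp, hpk, hp, hgap⟩ := exists_pred hM h0
      obtain ⟨t, ht⟩ := mem_columns.1 hp
      have ihp := ih (p - M).toNat (by omega) ht (by omega)
      have hsub : ∀ d ∈ S.walls, p < d → d ≤ k → d = k := fun d hd h1 h2 => by
        by_contra hne
        exact hgap d h1 (by omega) (S.isWalled.subset d hd)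
      have hwall : k ∈ S.walls ↔ s ≠ t := by
        rw [mem_walls]
        constructor
        · rintro ⟨k', s', t', h1, h2, h3, h4, h5⟩
          have e1 : k' = p := by
            rcases lt_trichotomy k' p with h | h | h
            · exact absurd hp (h5 p h hpk)
            · exact h
            · exact absurd (mem_columns_of_mem h4) (hgap k' h h1)
          subst e1
          rw [row_eq hk h3 (by simp), row_eq ht h4 (by simp)]
          exact h2
        · exact fun h => ⟨p, s, t, hpk, h, hk, ht, hgap⟩
      by_cases hst : s = t
      · have : wallCount S.walls k = wallCount S.walls p := by
          rw [wallCount, wallCount]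
          congr 1
          refine Finset.filter_congr fun d hd => ⟨fun hdk => ?_, fun hdp => hdp.trans hpk.le⟩
          by_contra hc
          have := hsub d hd (not_le.1 hc) hdk
          exact (hwall.1 (this ▸ hd)) hst
        rw [hst, this]
        exact ihp
      · have : wallCount S.walls k = wallCount S.walls p + 1 := by
          rw [wallCount, wallCount, ← Finset.card_insert_of_notMem (a := k)
            (fun h => by have := (Finset.mem_filter.1 h).2; omega)]
          congr 1
          ext d
          rw [Finset.mem_insert, Finset.mem_filter, Finset.mem_filter]
          constructor
          · rintro ⟨hd, hdk⟩
            by_cases hdp : d ≤ p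
            · exact Or.inr ⟨hd, hdp⟩
            · exact Or.inl (hsub d hd (not_le.1 hdp) hdk)
          · rintro (rfl | ⟨hd, hdp⟩)
            · exact ⟨hwall.2 hst, le_rfl⟩
            · exact ⟨hd, hdp.trans hpk.le⟩
        rw [this, Nat.even_add_one]
        refine Iff.trans ?_ (not_congr ihp)
        revert hst
        cases s <;> cases t <;> simp

lemma eq_of_columns_walls {S T : Config Row.lower} (h1 : S.columns = T.columns)
    (h2 : S.walls = T.walls) : S = T := by
  have key : ∀ {S T : Config Row.lower}, S.columns = T.columns → S.walls = T.walls →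
      S.carrier ⊆ T.carrier := by
    rintro S T h1 h2 ⟨k, s⟩ hs
    obtain ⟨t, ht⟩ := mem_columns.1 (h1 ▸ mem_columns_of_mem hs)
    have h3 := lower_iff_even hs
    rw [h2, ← lower_iff_even ht] at h3
    have : s = t := by
      revert h3
      cases s <;> cases t <;> simp
    exact this ▸ ht
  exact ext_carrier (Set.Subset.antisymm (key h1 h2) (key h1.symm h2.symm))

end Config

/-! ### Partitions into distinct and into odd parts -/

/-- The weight of a monomial in the variables `ψ_t`, where `ψ_t` has weight `2 t + 1`. -/
def bosonWeight (f : ℕ →₀ ℕ) : ℕ := f.sum fun t m => m * (2 * t + 1)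

lemma bosonWeight_add (f g : ℕ →₀ ℕ) : bosonWeight (f + g) = bosonWeight f + bosonWeight g :=
  Finsupp.sum_add_index' (by simp) (by intros; ring)

lemma bosonWeight_single (t m : ℕ) : bosonWeight (Finsupp.single t m) = m * (2 * t + 1) :=
  Finsupp.sum_single_index (by simp)

lemma bosonWeight_toFinsupp (s : Multiset ℕ) :
    bosonWeight (Multiset.toFinsupp s) = (s.map fun t => 2 * t + 1).sum := by
  induction s using Multiset.induction_on with
  | empty => simp [bosonWeight]
  | cons t s ih =>
    rw [← Multiset.singleton_add, map_add, bosonWeight_add, ih, Multiset.toFinsupp_singleton,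
      bosonWeight_single, Multiset.map_add, Multiset.sum_add, Multiset.map_singleton,
      Multiset.sum_singleton, one_mul]

/-- Euler's equality of the numbers of partitions into distinct and into odd parts gives some
bijection. An odd part 2t + 1 then becomes a factor ψ_t. -/
lemma exists_distincts_injection (n : ℕ) : ∃ G : Nat.Partition n → (ℕ →₀ ℕ),
    (∀ p ∈ Nat.Partition.distincts n, bosonWeight (G p) = n) ∧
      Set.InjOn G (Nat.Partition.distincts n) := by
  let e := Finset.equivOfCardEq (Nat.Partition.card_odds_eq_card_distincts n).symm
  have back : ∀ q ∈ Nat.Partition.odds n, (q.parts.map (· / 2)).map (fun t => 2 * t + 1) = q.parts := by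
    intro q hq
    rw [Multiset.map_map]
    conv_rhs => rw [← Multiset.map_id q.parts]
    refine Multiset.map_congr rfl fun i hi => ?_
    simp only [Nat.Partition.odds, Nat.Partition.restricted, Finset.mem_filter] at hq
    have := hq.2 i hi
    simp only [Function.comp, id]
    rw [Nat.not_even_iff] at this
    omega
  refine ⟨fun p => if h : p ∈ Nat.Partition.distincts n then
    Multiset.toFinsupp ((e ⟨p, h⟩).1.parts.map (· / 2)) else 0, fun p hp => ?_, fun p hp q hq hpq => ?_⟩
  · simp only [hp, dite_true]
    rw [bosonWeight_toFinsupp, back _ (e ⟨p, hp⟩).2, Nat.Partition.parts_sum]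
  · rw [Finset.mem_coe] at hp hq
    simp only [hp, hq, dite_true] at hpq
    have h1 := congrArg (Multiset.map fun t => 2 * t + 1) (Multiset.toFinsupp.injective hpq)
    rw [back _ (e ⟨p, hp⟩).2, back _ (e ⟨q, hq⟩).2] at h1
    exact congrArg Subtype.val (e.injective (Subtype.ext (Nat.Partition.ext h1)))

/-- The partition whose parts form a given set. -/
def finsetPartition (J : Finset ℕ) (h0 : 0 ∉ J) (n : ℕ) (hn : ∑ j ∈ J, j = n) :
    Nat.Partition n where
  parts := J.val
  parts_pos hi := Nat.pos_of_ne_zero fun e => h0 (e ▸ hi)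
  parts_sum := by rw [← hn, Finset.sum_val]; rfl

lemma exists_finset_injection : ∃ F : Finset ℕ → (ℕ →₀ ℕ),
    (∀ J, 0 ∉ J → bosonWeight (F J) = ∑ j ∈ J, j) ∧ Set.InjOn F {J | 0 ∉ J} := by
  choose G hG1 hG2 using exists_distincts_injection
  have hd : ∀ (J : Finset ℕ) (h0 : 0 ∉ J) (n : ℕ) (hn : ∑ j ∈ J, j = n),
      finsetPartition J h0 n hn ∈ Nat.Partition.distincts n := fun J h0 n hn =>
    Finset.mem_filter.2 ⟨Finset.mem_univ _, J.nodup⟩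
  let F : Finset ℕ → (ℕ →₀ ℕ) := fun J =>
    if h : 0 ∉ J then G (∑ j ∈ J, j) (finsetPartition J h _ rfl) else 0
  -- The size n is left free, so that two sets of equal sum can be compared inside one type of
  -- partitions.
  have hF : ∀ (J : Finset ℕ) (h0 : 0 ∉ J) (n : ℕ) (hn : ∑ j ∈ J, j = n),
      F J = G n (finsetPartition J h0 n hn) := by
    intro J h0 n hn
    subst hn
    exact dif_pos h0
  have hw : ∀ J, 0 ∉ J → bosonWeight (F J) = ∑ j ∈ J, j := fun J h0 => by
    rw [hF J h0 _ rfl, hG1 _ _ (hd _ _ _ _)]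
  refine ⟨F, hw, fun J hJ K hK e => ?_⟩
  have hs : ∑ j ∈ K, j = ∑ j ∈ J, j := by rw [← hw J hJ, ← hw K hK, e]
  rw [hF J hJ _ rfl, hF K hK _ hs] at e
  have := congrArg Nat.Partition.parts (hG2 _ (hd _ _ _ _) (hd _ _ _ _) e)
  exact Finset.val_injective this

/-- The charge and the energy of a basis vector of the Fock space. -/
def fockWeight (p : DiracSet × (ℕ →₀ ℕ)) : ℤ × ℤ :=
  (diracCharge p.1.1, diracEnergy p.1.1 + bosonWeight p.2)

/-- Positivity of the ranks makes them the parts of a partition, and their sum is the energy lost by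
the shift. The boson weight restores it. -/
lemma exists_config_injection : ∃ f : Config Row.lower → DiracSet × (ℕ →₀ ℕ),
    Function.Injective f ∧ ∀ S, fockWeight (f S) = (S.charge, S.energy) := by
  obtain ⟨F, hF1, hF2⟩ := exists_finset_injection
  have hpos : ∀ S : Config Row.lower, 0 ∉ S.walls.image (rank S.columns) := by
    intro S h
    obtain ⟨d, hd, e⟩ := Finset.mem_image.1 h
    exact (rank_pos S.isDirac_columns (S.isWalled.subset d hd)).ne' e
  refine ⟨fun S => (⟨shift S.walls '' S.columns, S.isWalled.shift_image.1⟩,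
    F (S.walls.image (rank S.columns))), fun S T e => ?_, fun S => ?_⟩
  · rw [Prod.mk.injEq, Subtype.mk.injEq] at e
    obtain ⟨h1, h2⟩ := S.isWalled.eq_of_shift_eq T.isWalled e.1 (hF2 (hpos S) (hpos T) e.2)
    exact Config.eq_of_columns_walls h1 h2
  · obtain ⟨-, h1, h2⟩ := S.isWalled.shift_image
    refine Prod.ext h1 ?_
    simp only [fockWeight, hF1 _ (hpos S), Nat.cast_sum]
    exact h2

end SquareLadder

end

noncomputable section

namespace SquareLadder

open Finsupp

/-! ### The grading of the Fock space -/

/-- The operator that is diagonal in the standard basis of the Fock space. -/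
def diagOp (w : DiracSet × (ℕ →₀ ℕ) → ℂ) : Module.End ℂ Fock :=
  linearCombination ℂ fun p => single p (w p)

lemma diagOp_single (w : DiracSet × (ℕ →₀ ℕ) → ℂ) (p : DiracSet × (ℕ →₀ ℕ)) (c : ℂ) :
    diagOp w (single p c) = single p (c * w p) := by
  simp [diagOp, linearCombination_single]

/-- The operator is homogeneous of degree `a` with respect to a diagonal operator. -/
def HasDegree (w : DiracSet × (ℕ →₀ ℕ) → ℂ) (T : Module.End ℂ Fock) (a : ℂ) : Prop :=
  ∀ v, diagOp w (T v) = T (diagOp w v) + a • T v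

lemma HasDegree.comp {w : DiracSet × (ℕ →₀ ℕ) → ℂ} {S T : Module.End ℂ Fock} {a b : ℂ}
    (hS : HasDegree w S a) (hT : HasDegree w T b) : HasDegree w (S ∘ₗ T) (a + b) := fun v => by
  rw [LinearMap.comp_apply, LinearMap.comp_apply, hS, hT, map_add, map_smul, add_smul]
  abel

lemma hasDegree_create {w : DiracSet × (ℕ →₀ ℕ) → ℂ} {k : ℤ} {a : ℂ}
    (h : ∀ (Ω : DiracSet) f, k ∉ Ω.1 → w (Ω.insert k, f) = w (Ω, f) + a) :
    HasDegree w (create k) a := by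
  intro v
  induction v using Finsupp.induction_linear with
  | zero => simp
  | add v v' hv hv' => simp only [map_add, hv, hv', smul_add]; abel
  | single p c =>
    obtain ⟨Ω, f⟩ := p
    by_cases hk : k ∈ Ω.1
    · simp only [diagOp_single, create_of_mem hk, map_zero, smul_zero, add_zero]
    · simp only [diagOp_single, create_of_notMem hk, h Ω f hk, smul_single, ← single_add,
        smul_eq_mul]
      congr 1; ring

lemma hasDegree_boson {w : DiracSet × (ℕ →₀ ℕ) → ℂ} {t : ℕ} {a : ℂ}
    (h : ∀ (Ω : DiracSet) f, w (Ω, f + single t 1) = w (Ω, f) + a) :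
    HasDegree w (boson t) a := by
  intro v
  induction v using Finsupp.induction_linear with
  | zero => simp
  | add v v' hv hv' => simp only [map_add, hv, hv', smul_add]; abel
  | single p c =>
    obtain ⟨Ω, f⟩ := p
    simp only [diagOp_single, boson_single, h Ω f, smul_single, ← single_add, smul_eq_mul]
    congr 1; ring

lemma hasDegree_upperOp {w : DiracSet × (ℕ →₀ ℕ) → ℂ} {i : ℤ} {a : ℂ}
    (h : ∀ t, HasDegree w (upperTerm i t) a) : HasDegree w (upperOp i) a := by
  intro v
  -- Two bounds are taken, so that a common truncation works for v and for its image under the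
  -- diagonal operator.
  obtain ⟨K, hK⟩ := exists_filledBelow v
  obtain ⟨L, hL⟩ := exists_filledBelow (diagOp w v)
  rw [hK.upperOp_eq (n := (i - min K L).toNat) (by omega),
    hL.upperOp_eq (n := (i - min K L).toNat) (by omega), map_sum, Finset.smul_sum,
    ← Finset.sum_add_distrib]
  exact Finset.sum_congr rfl fun t _ => h t v

/-- The charge operator of the Fock space. -/
def fockCharge : Module.End ℂ Fock := diagOp fun p => ((fockWeight p).1 : ℂ)

/-- The energy operator of the Fock space. -/
def fockEnergy : Module.End ℂ Fock := diagOp fun p => ((fockWeight p).2 : ℂ)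

lemma charge_create (k : ℤ) : HasDegree (fun p => ((fockWeight p).1 : ℂ)) (create k) 1 :=
  hasDegree_create fun Ω f hk => by
    simp only [fockWeight, DiracSet.insert, diracCharge_insert Ω.2 hk]; push_cast; ring

lemma energy_create (k : ℤ) : HasDegree (fun p => ((fockWeight p).2 : ℂ)) (create k) k :=
  hasDegree_create fun Ω f hk => by
    simp only [fockWeight, DiracSet.insert, diracEnergy_insert Ω.2 hk]; push_cast; ring

lemma charge_upperOp (i : ℤ) : HasDegree (fun p => ((fockWeight p).1 : ℂ)) (upperOp i) 1 := by
  refine hasDegree_upperOp fun t => ?_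
  have h := (hasDegree_boson (w := fun p => ((fockWeight p).1 : ℂ)) (t := t) (a := 0)
    fun Ω f => by simp [fockWeight]).comp (charge_create (i - 2 * t - 1))
  rwa [zero_add] at h

/-- The weight 2t + 1 of ψ_t compensates the displacement of the column i - 2t - 1, so all terms
have energy i. -/
lemma energy_upperOp (i : ℤ) : HasDegree (fun p => ((fockWeight p).2 : ℂ)) (upperOp i) i := by
  refine hasDegree_upperOp fun t => ?_
  have h := (hasDegree_boson (w := fun p => ((fockWeight p).2 : ℂ)) (t := t) (a := 2 * t + 1)
    fun Ω f => by
      simp only [fockWeight, bosonWeight_add, bosonWeight_single]; push_cast; ring).comp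
    (energy_create (i - 2 * t - 1))
  have e : (2 * (t : ℂ) + 1 + ((i - 2 * t - 1 : ℤ) : ℂ)) = i := by push_cast; ring
  rwa [e] at h

lemma fockCharge_x (i : ℤ) (v : Fock) : fockCharge (x i • v) = x i • fockCharge v + x i • v := by
  simp only [x_smul]
  exact (charge_upperOp _ v).trans (by rw [one_smul]; rfl)

lemma fockCharge_y (i : ℤ) (v : Fock) : fockCharge (y i • v) = y i • fockCharge v + y i • v := by
  simp only [y_smul]
  exact (charge_create _ v).trans (by rw [one_smul]; rfl)

lemma fockEnergy_x (i : ℤ) (v : Fock) :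
    fockEnergy (x i • v) = x i • fockEnergy v + (-(i : ℂ)) • x i • v := by
  simp only [x_smul]
  exact (energy_upperOp _ v).trans (by rw [Int.cast_neg]; rfl)

lemma fockEnergy_y (i : ℤ) (v : Fock) :
    fockEnergy (y i • v) = y i • fockEnergy v + (-(i : ℂ)) • y i • v := by
  simp only [y_smul]
  exact (energy_create _ v).trans (by rw [Int.cast_neg]; rfl)

lemma fockCharge_vac (N : ℤ) : fockCharge (vac N) = (-(N : ℂ)) • vac N := by
  rw [fockCharge, vac, diagOp_single, smul_single, smul_eq_mul, mul_one, one_mul]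
  simp only [fockWeight, (dirac_iio (-N)).1, Int.cast_neg]

lemma fockEnergy_vac (N : ℤ) :
    fockEnergy (vac N) = ((N : ℂ) * ((N : ℂ) + 1) / 2) • vac N := by
  rw [fockEnergy, vac, diagOp_single, smul_single, smul_eq_mul, mul_one, one_mul]
  have h := congrArg (Int.cast : ℤ → ℂ) (dirac_iio (-N)).2
  push_cast at h
  congr 1
  simp only [fockWeight, bosonWeight, sum_zero_index]
  push_cast
  linear_combination h / 2

lemma fock_commute (v : Fock) : fockCharge (fockEnergy v) = fockEnergy (fockCharge v) := by
  induction v using Finsupp.induction_linear with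
  | zero => simp
  | add v w hv hw => simp only [map_add, hv, hw]
  | single p c => simp only [fockCharge, fockEnergy, diagOp_single]; congr 1; ring

lemma smul_fock_comm (a : Fermion) (c : ℂ) (v : Fock) : a • c • v = c • a • v := by
  simp only [fermion_smul_def, map_smul]

/-! ### Weights of the monomials. -/

lemma eigen_prod {D : Module.End ℂ Fock} {h : ℤ → Fermion} {d : ℤ → ℂ}
    (hD : ∀ i v, D (h i • v) = h i • D v + d i • h i • v) (l : List ℤ) {v : Fock} {a : ℂ}
    (hv : D v = a • v) :
    D ((l.map h).prod • v) = ((l.map d).sum + a) • (l.map h).prod • v := by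
  induction l with
  | nil => simpa using hv
  | cons i l ih =>
    rw [List.map_cons, List.prod_cons, mul_smul, hD, ih, List.map_cons, List.sum_cons,
      smul_fock_comm, ← add_smul]
    congr 1; ring

lemma sum_sort (A : Finset ℤ) (d : ℤ → ℂ) :
    ((A.sort (· ≤ ·)).map d).sum = ∑ i ∈ A, d i := by
  rw [← Finset.sum_map_toList]
  exact ((Finset.sort_perm_toList _ _).map d).sum_eq

lemma fockCharge_monomial (N : ℤ) (A B : Finset ℤ) :
    fockCharge (monomial A B • vac N) = ((A.card : ℂ) + B.card - N) • monomial A B • vac N := by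
  rw [monomial, mul_smul, eigen_prod (d := fun _ => 1)
    (fun i v => by rw [fockCharge_x, one_smul]) _ (eigen_prod (d := fun _ => 1)
      (fun i v => by rw [fockCharge_y, one_smul]) _ (fockCharge_vac N)), sum_sort, sum_sort]
  congr 1
  simp; ring

lemma fockEnergy_monomial (N : ℤ) (A B : Finset ℤ) :
    fockEnergy (monomial A B • vac N) =
      (∑ i ∈ A, -(i : ℂ) + (∑ j ∈ B, -(j : ℂ) + (N : ℂ) * ((N : ℂ) + 1) / 2)) •
        monomial A B • vac N := by
  rw [monomial, mul_smul, eigen_prod fockEnergy_x _ (eigen_prod fockEnergy_y _ (fockEnergy_vac N)),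
    sum_sort, sum_sort]

/-! ### Monomials and configurations -/

section

variable {S : Config Row.lower} {N : ℤ} {A B : Finset ℤ}

lemma Represents.columns_eq (h : Represents S N A B) :
    S.columns = Set.Iio (-N) ∪ (((A ∪ B).image (- ·) : Finset ℤ) : Set ℤ) := by
  obtain ⟨h1, h2, h3⟩ := h
  ext k
  rw [Config.mem_columns]
  simp only [Set.mem_union, Set.mem_Iio, Finset.mem_coe, Finset.mem_image, Finset.mem_union]
  constructor
  · rintro ⟨s, hs⟩
    cases s
    · exact Or.inr ⟨-k, Or.inl ((h1 _).2 (by rwa [neg_neg])), neg_neg k⟩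
    · by_cases hk : k < -N
      · exact Or.inl hk
      · exact Or.inr ⟨-k, Or.inr ((h2 _).2 ⟨by omega, by rwa [neg_neg]⟩), neg_neg k⟩
  · rintro (hk | ⟨i, hi | hi, rfl⟩)
    · exact ⟨_, by simpa using h3 (-k) (by omega)⟩
    · exact ⟨_, (h1 i).1 hi⟩
    · exact ⟨_, ((h2 i).1 hi).2⟩

lemma Represents.admissible (h : Represents S N A B) : Admissible N A B := by
  obtain ⟨h1, h2, h3⟩ := h
  refine ⟨fun i hi => ?_, fun j hj => ((h2 j).1 hj).1, fun i hi j hj => ?_⟩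
  · by_contra hc
    -- If i ≥ N, then y_{i+1} belongs to the tail and is adjacent to x_i. Hence the bound N - 1
    -- rather than N for the upper row.
    have h4 := h3 (i + 1) (by omega)
    exact absurd (Config.row_eq ((h1 i).1 hi) h4 (by rw [abs_le]; omega)) (by simp)
  · by_contra hc
    have h4 := Config.row_eq ((h1 i).1 hi) ((h2 j).1 hj).2 (by
      rw [not_le, abs_lt] at hc; rw [abs_le]; omega)
    exact absurd h4 (by simp)

lemma Admissible.disjoint (h : Admissible N A B) : Disjoint A B :=
  Finset.disjoint_left.2 fun i hA hB => by simpa using h.2.2 i hA i hB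

lemma Admissible.le_neg (h : Admissible N A B) : ∀ k ∈ (A ∪ B).image (- ·), -N ≤ k := by
  intro k hk
  obtain ⟨i, hi, rfl⟩ := Finset.mem_image.1 hk
  rcases Finset.mem_union.1 hi with hi | hi
  · have := h.1 i hi; omega
  · have := h.2.1 i hi; omega

lemma Represents.charge_eq (h : Represents S N A B) :
    (S.charge : ℂ) = (A.card : ℂ) + B.card - N := by
  have h1 := (iio_union_finset _ _ h.admissible.le_neg).2.1
  rw [← h.columns_eq, Finset.card_image_of_injective _ neg_injective,
    Finset.card_union_of_disjoint h.admissible.disjoint] at h1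
  have h2 : S.charge = _ := h1
  rw [h2]; push_cast; ring

lemma Represents.energy_eq (h : Represents S N A B) :
    (S.energy : ℂ) = ∑ i ∈ A, -(i : ℂ) + (∑ j ∈ B, -(j : ℂ) + (N : ℂ) * ((N : ℂ) + 1) / 2) := by
  have h1 := (iio_union_finset _ _ h.admissible.le_neg).2.2
  rw [← h.columns_eq, Finset.sum_image (fun a _ b _ e => neg_injective e),
    Finset.sum_union h.admissible.disjoint] at h1
  have h2 : 2 * S.energy = _ := h1
  have h3 := congrArg (Int.cast : ℤ → ℂ) h2
  push_cast at h3
  linear_combination h3 / 2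

lemma Admissible.exists_represents (h : Admissible N A B) :
    ∃ S : Config Row.lower, Represents S N A B := by
  have hmem : ∀ (k : ℤ), ((∃ v ∈ {v : ℤ × Row | (v.2 = Row.upper ∧ -v.1 ∈ A) ∨
      (v.2 = Row.lower ∧ (-v.1 ∈ B ∨ N < -v.1))}, v.1 = k)) ↔
      k ∈ Set.Iio (-N) ∪ (((A ∪ B).image (- ·) : Finset ℤ) : Set ℤ) := by
    intro k
    simp only [Set.mem_union, Set.mem_Iio, Finset.mem_coe, Finset.mem_image, Finset.mem_union]
    constructor
    · rintro ⟨⟨j, s⟩, ⟨-, hj⟩ | ⟨-, hj | hj⟩, rfl⟩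
      · exact Or.inr ⟨_, Or.inl hj, neg_neg _⟩
      · exact Or.inr ⟨_, Or.inr hj, neg_neg _⟩
      · exact Or.inl (by simp only at hj ⊢; omega)
    · rintro (hk | ⟨i, hi | hi, rfl⟩)
      · exact ⟨(k, Row.lower), Or.inr ⟨rfl, Or.inr (by simp only; omega)⟩, rfl⟩
      · exact ⟨(-i, Row.upper), Or.inl ⟨rfl, by simpa using hi⟩, rfl⟩
      · exact ⟨(-i, Row.lower), Or.inr ⟨rfl, Or.inl (by simpa using hi)⟩, rfl⟩
  have far : ∀ (i j : ℤ), -i ∈ A → (-j ∈ B ∨ N < -j) → ¬|i - j| ≤ 1 := by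
    intro i j hi hj hij
    rw [abs_le] at hij
    rcases hj with hj | hj
    · have := h.2.2 _ hi _ hj
      rw [le_abs] at this
      omega
    · have := h.1 _ hi
      omega
  refine ⟨⟨{v | (v.2 = Row.upper ∧ -v.1 ∈ A) ∨ (v.2 = Row.lower ∧ (-v.1 ∈ B ∨ N < -v.1))},
    ?_, ?_, ?_⟩, ?_, ?_, ?_⟩
  · rintro ⟨i, s⟩ hv ⟨j, t⟩ hw - ⟨hst, hij⟩
    rcases hv with ⟨rfl, hi⟩ | ⟨rfl, hi⟩ <;> rcases hw with ⟨rfl, hj⟩ | ⟨rfl, hj⟩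
    · exact hst rfl
    · exact far i j hi hj hij
    · exact far j i hj hi (by rwa [abs_sub_comm])
    · exact hst rfl
  · have e := Set.ext hmem
    have := (iio_union_finset _ _ h.le_neg).1
    rw [← e] at this
    exact this
  · exact ⟨-N - 1, fun k hk => Or.inr ⟨rfl, Or.inr (by simp only; omega)⟩⟩
  · intro i
    simp
  · intro j
    have := h.2.1 j
    simp only [Set.mem_ofPred_eq, neg_neg, reduceCtorEq, false_and, true_and, false_or]
    constructor
    · exact fun hj => ⟨this hj, Or.inl hj⟩
    · rintro ⟨h1, h2 | h2⟩
      · exact h2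
      · omega
  · intro j hj
    exact Or.inr ⟨rfl, Or.inr (by simpa using hj)⟩

lemma exists_represents (S : Config Row.lower) : ∃ N A B, Represents S N A B := by
  obtain ⟨M, hM⟩ := S.tail
  have hfin := S.isDirac_columns.finite_ge M
  have hA : {i : ℤ | (-i, Row.upper) ∈ S.carrier}.Finite := by
    refine (hfin.image (- ·)).subset fun i hi => ⟨-i, ⟨Config.mem_columns_of_mem hi, ?_⟩, neg_neg i⟩
    by_contra hc
    exact absurd (Config.row_eq hi (hM (-i) (by omega)) (by simp)) (by simp)
  have hB : {j : ℤ | j ≤ -M ∧ (-j, Row.lower) ∈ S.carrier}.Finite := by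
    refine (hfin.image (- ·)).subset fun j hj => ⟨-j, ⟨Config.mem_columns_of_mem hj.2, ?_⟩, neg_neg j⟩
    have := hj.1
    omega
  refine ⟨-M, hA.toFinset, hB.toFinset, fun i => ?_, fun j => ?_, fun j hj => hM _ (by omega)⟩
  · rw [Set.Finite.mem_toFinset]; rfl
  · rw [Set.Finite.mem_toFinset]; rfl

/-! ### Independence of the monomial from the cut-off N. -/

lemma sort_insert_max {B : Finset ℤ} {m : ℤ} (hm : ∀ j ∈ B, j < m) :
    (insert m B).sort (· ≤ ·) = B.sort (· ≤ ·) ++ [m] := by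
  have hmB : m ∉ B := fun h => (hm m h).false
  refine List.Perm.eq_of_pairwise' (r := (· ≤ ·)) (Finset.pairwise_sort _ _) ?_ ?_
  · rw [List.pairwise_append]
    refine ⟨Finset.pairwise_sort _ _, List.pairwise_singleton _ _, fun a ha b hb => ?_⟩
    rw [List.mem_singleton] at hb
    rw [Finset.mem_sort] at ha
    exact hb ▸ (hm a ha).le
  · rw [List.perm_ext_iff_of_nodup (Finset.sort_nodup _ _)]
    · intro a
      simp only [Finset.mem_sort, Finset.mem_insert, List.mem_append, List.mem_singleton]
      tauto
    · rw [List.nodup_append]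
      refine ⟨Finset.sort_nodup _ _, List.nodup_singleton _, fun a ha b hb => ?_⟩
      rw [List.mem_singleton] at hb
      rw [Finset.mem_sort] at ha
      exact hb ▸ (hm a ha).ne

lemma monomial_insert_max {m : ℤ} (hm : ∀ j ∈ B, j < m) :
    monomial A (insert m B) = monomial A B * y m := by
  simp [monomial, sort_insert_max hm, mul_assoc]

lemma Represents.succ (h : Represents S N A B) : Represents S (N + 1) A (insert (N + 1) B) := by
  obtain ⟨h1, h2, h3⟩ := h
  refine ⟨h1, fun j => ?_, fun j hj => h3 j (by omega)⟩
  rw [Finset.mem_insert, h2]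
  constructor
  · rintro (rfl | ⟨hj, h4⟩)
    · exact ⟨le_rfl, h3 _ (by omega)⟩
    · exact ⟨by omega, h4⟩
  · rintro ⟨hj, h4⟩
    by_cases e : j = N + 1
    · exact Or.inl e
    · exact Or.inr ⟨by omega, h4⟩

lemma y_smul_extreme (N : ℤ) : y (N + 1) • extreme (N + 1) = extreme N := by
  have h := yProd_smul_extreme N 1
  simpa [yProd] using h

lemma Represents.unique {A' B' : Finset ℤ} (h : Represents S N A B) (h' : Represents S N A' B') :
    A = A' ∧ B = B' :=
  ⟨Finset.ext fun i => (h.1 i).trans (h'.1 i).symm,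
    Finset.ext fun j => (h.2.1 j).trans (h'.2.1 j).symm⟩

/-- Raising the cut-off appends y_{N+1} as the last factor, where γ_N = y_{N+1} γ_{N+1} absorbs it
without a sign. -/
lemma Represents.exists_shift (h : Represents S N A B) (d : ℕ) :
    ∃ B', Represents S (N + d) A B' ∧ monomial A B • extreme N = monomial A B' • extreme (N + d) := by
  induction d with
  | zero => exact ⟨B, by simpa using h, by simp⟩
  | succ d ih =>
    obtain ⟨B', h1, h2⟩ := ih
    refine ⟨insert (N + d + 1) B', ?_, ?_⟩
    · rw [Nat.cast_succ, ← add_assoc]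
      exact h1.succ
    · rw [h2, monomial_insert_max (fun j hj => by have := h1.admissible.2.1 j hj; omega), mul_smul,
        Nat.cast_succ, ← add_assoc, y_smul_extreme]

lemma Represents.smul_extreme_eq {N' : ℤ} {A' B' : Finset ℤ} (h : Represents S N A B)
    (h' : Represents S N' A' B') : monomial A B • extreme N = monomial A' B' • extreme N' := by
  wlog hN : N ≤ N' generalizing N N' A A' B B'
  · exact (this h' h (by omega)).symm
  obtain ⟨d, rfl⟩ : ∃ d : ℕ, N' = N + d := ⟨(N' - N).toNat, by omega⟩
  obtain ⟨B'', h1, h2⟩ := h.exists_shift d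
  obtain ⟨rfl, rfl⟩ := h1.unique h'
  exact h2

end

/-- The vector of `Υ` that corresponds to a configuration. -/
def configVector (S : Config Row.lower) : Upsilon :=
  monomial (exists_represents S).choose_spec.choose
    (exists_represents S).choose_spec.choose_spec.choose • extreme (exists_represents S).choose

lemma configVector_eq {S : Config Row.lower} {N : ℤ} {A B : Finset ℤ} (h : Represents S N A B) :
    configVector S = monomial A B • extreme N :=
  (exists_represents S).choose_spec.choose_spec.choose_spec.smul_extreme_eq h

lemma span_configVector : Submodule.span ℂ (Set.range configVector) = ⊤ := by
  rw [eq_top_iff]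
  rintro v -
  obtain ⟨N, a, rfl⟩ := exists_smul_extreme v
  refine Submodule.span_le.2 ?_ (smul_extreme_mem N a)
  rintro _ ⟨A, B, hAB, rfl⟩
  obtain ⟨S, hS⟩ := hAB.exists_represents
  exact Submodule.subset_span ⟨S, configVector_eq hS⟩

lemma fockCharge_configVector (S : Config Row.lower) :
    fockCharge (toFock (configVector S)) = (S.charge : ℂ) • toFock (configVector S) := by
  obtain ⟨N, A, B, h⟩ := exists_represents S
  rw [configVector_eq h, map_smul, toFock_extreme, fockCharge_monomial, h.charge_eq]

lemma fockEnergy_configVector (S : Config Row.lower) :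
    fockEnergy (toFock (configVector S)) = (S.energy : ℂ) • toFock (configVector S) := by
  obtain ⟨N, A, B, h⟩ := exists_represents S
  rw [configVector_eq h, map_smul, toFock_extreme, fockEnergy_monomial, h.energy_eq]

/-! ### Linear algebra -/

lemma diagOp_apply (w : DiracSet × (ℕ →₀ ℕ) → ℂ) (v : Fock) (p : DiracSet × (ℕ →₀ ℕ)) :
    diagOp w v p = w p * v p := by
  induction v using Finsupp.induction_linear with
  | zero => simp
  | add v v' hv hv' => rw [map_add, Finsupp.add_apply, hv, hv', Finsupp.add_apply, mul_add]
  | single q c =>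
    classical
    rw [diagOp_single, single_apply, single_apply]
    split_ifs with h
    · rw [h, mul_comm]
    · rw [mul_zero]

/-- The charge and energy operators are diagonal in the standard basis, so a joint eigenvector is
supported on basis vectors of its own weight. -/
lemma fockWeight_of_mem_support (S : Config Row.lower) (p : DiracSet × (ℕ →₀ ℕ))
    (hp : toFock (configVector S) p ≠ 0) : fockWeight p = (S.charge, S.energy) := by
  have h1 := DFunLike.congr_fun (fockCharge_configVector S) p
  have h2 := DFunLike.congr_fun (fockEnergy_configVector S) p
  rw [fockCharge, diagOp_apply, Finsupp.smul_apply, smul_eq_mul] at h1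
  rw [fockEnergy, diagOp_apply, Finsupp.smul_apply, smul_eq_mul] at h2
  exact Prod.ext (Int.cast_injective (mul_right_cancel₀ hp h1))
    (Int.cast_injective (mul_right_cancel₀ hp h2))

/-- A spanning family of homogeneous vectors is linearly independent if its members are, in each
degree, not more numerous than the vectors of the standard basis. -/
lemma linearIndependent_of_graded {ι P W : Type*} (v : ι → P →₀ ℂ) (wι : ι → W) (wP : P → W)
    (hom : ∀ i p, v i p ≠ 0 → wP p = wι i) (hspan : Submodule.span ℂ (Set.range v) = ⊤)
    (f : ι → P) (hf : Function.Injective f) (hfw : ∀ i, wP (f i) = wι i)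
    (hfin : ∀ w, {i | wι i = w}.Finite) : LinearIndependent ℂ v := by
  classical
  -- Projection to degree w kills the members of other degrees, so in each degree the remaining
  -- finitely many members still span.
  have hR : ∀ w i, wι i ≠ w → restrictDom ℂ ℂ {p | wP p = w} (v i) = 0 := by
    intro w i hi
    refine Subtype.ext (Finsupp.ext fun p => ?_)
    rw [restrictDom_apply, filter_apply]
    split_ifs with hp
    · by_contra hne
      exact hi ((hom i p hne).symm.trans hp)
    · rfl
  have hind : ∀ w, LinearIndependent ℂ
      (fun i : {i // wι i = w} => restrictDom ℂ ℂ {p | wP p = w} (v i)) := by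
    intro w
    have : Fintype {i // wι i = w} := (hfin w).fintype
    have hsp : ⊤ ≤ Submodule.span ℂ (Set.range
        (fun i : {i // wι i = w} => restrictDom ℂ ℂ {p | wP p = w} (v i))) := by
      have h1 : Submodule.map (restrictDom ℂ ℂ {p | wP p = w}) ⊤ = ⊤ := by
        rw [Submodule.map_top]
        exact range_restrictDom _
      rw [← h1, ← hspan, Submodule.map_span, Submodule.span_le]
      rintro _ ⟨_, ⟨i, rfl⟩, rfl⟩
      by_cases hi : wι i = w
      · exact Submodule.subset_span ⟨⟨i, hi⟩, rfl⟩
      · rw [hR w i hi]; exact Submodule.zero_mem _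
    -- The degree part is finite-dimensional because a finite family spans it. The injection f then
    -- provides as many independent vectors as this family has members, which forces the family to
    -- be independent.
    have : Module.Finite ℂ (supported ℂ ℂ {p | wP p = w}) :=
      ⟨⟨(Set.finite_range
        (fun i : {i // wι i = w} => restrictDom ℂ ℂ {p | wP p = w} (v i))).toFinset, by
        rw [Set.Finite.coe_toFinset]; exact top_le_iff.1 hsp⟩⟩
    refine linearIndependent_of_top_le_span_of_card_le_finrank hsp ?_
    have hli : LinearIndependent ℂ (fun i : {i // wι i = w} =>
        (⟨single (f i) 1, single_mem_supported ℂ _ ((hfw i).trans i.2)⟩ :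
          supported ℂ ℂ {p | wP p = w})) := by
      refine LinearIndependent.of_comp (Submodule.subtype _) ?_
      exact (linearIndependent_single_one ℂ P).comp (fun i : {i // wι i = w} => f i)
        (hf.comp Subtype.val_injective)
    exact hli.fintype_card_le_finrank
  rw [linearIndependent_iff']
  intro s g hs i hi
  have h1 := congrArg (restrictDom ℂ ℂ {p | wP p = wι i}) hs
  rw [map_sum, map_zero] at h1
  have h2 : ∑ j ∈ s.subtype (fun j => wι j = wι i),
      g j • restrictDom ℂ ℂ {p | wP p = wι i} (v j) = 0 := by
    rw [Finset.sum_subtype_eq_sum_filter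
      (f := fun j => g j • restrictDom ℂ ℂ {p | wP p = wι i} (v j)), Finset.sum_filter]
    refine Eq.trans (Finset.sum_congr rfl fun j _ => ?_) h1
    split_ifs with hj
    · rw [map_smul]
    · rw [map_smul, hR _ _ hj, smul_zero]
  exact linearIndependent_iff'.1 (hind (wι i)) _ (fun j => g j) h2 ⟨i, rfl⟩ (by simpa using hi)

/-- The map `Υ → Fock` as a map of complex vector spaces. -/
def toFockC : Upsilon →ₗ[ℂ] Fock := toFock.restrictScalars ℂ

lemma span_fock_configVector :
    Submodule.span ℂ (Set.range fun S => toFockC (configVector S)) = ⊤ := by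
  have h : Submodule.map toFockC ⊤ = ⊤ := by
    rw [Submodule.map_top, LinearMap.range_eq_top]
    exact toFock_surjective
  rw [← h, ← span_configVector, Submodule.map_span, ← Set.range_comp]
  rfl

lemma linearIndependent_fock_configVector :
    LinearIndependent ℂ (fun S => toFockC (configVector S)) := by
  obtain ⟨f, hf1, hf2⟩ := exists_config_injection
  refine linearIndependent_of_graded _ (fun S : Config Row.lower => (S.charge, S.energy)) fockWeight
    fockWeight_of_mem_support span_fock_configVector f hf1 hf2 fun w => ?_
  exact (configsOf_finite Row.lower w.1 w.2).subset fun S hS =>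
    ⟨congrArg Prod.fst hS, congrArg Prod.snd hS⟩

/-- The basis of `Υ` formed by the vectors of the configurations. -/
def configBasis : Module.Basis (Config Row.lower) ℂ Upsilon :=
  Module.Basis.mk (LinearIndependent.of_comp toFockC linearIndependent_fock_configVector)
    span_configVector.ge

lemma configBasis_apply (S : Config Row.lower) : configBasis S = configVector S :=
  Module.Basis.mk_apply _ _ _

/-- The isomorphism `Υ ≃ Fock`. -/
def fockEquiv : Upsilon ≃ₗ[ℂ] Fock :=
  configBasis.equiv
    (Module.Basis.mk linearIndependent_fock_configVector span_fock_configVector.ge) (Equiv.refl _)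

/-- The isomorphism was defined by matching bases; its identification with `toFock` makes it
compatible with the action of the algebra. -/
lemma fockEquiv_apply (v : Upsilon) : fockEquiv v = toFock v := by
  have h : fockEquiv.toLinearMap = toFockC := configBasis.ext fun S => by
    rw [LinearEquiv.coe_coe, fockEquiv, Module.Basis.equiv_apply, Module.Basis.mk_apply,
      configBasis_apply, Equiv.refl_apply]
  exact LinearMap.congr_fun h v

lemma fockEquiv_smul (a : Fermion) (v : Upsilon) : fockEquiv (a • v) = a • fockEquiv v := by
  rw [fockEquiv_apply, fockEquiv_apply, map_smul]

/-- The operator `c`. -/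
def chargeOp : Module.End ℂ Upsilon := fockEquiv.symm.toLinearMap ∘ₗ fockCharge ∘ₗ fockEquiv.toLinearMap

/-- The operator `u`. -/
def energyOp : Module.End ℂ Upsilon := fockEquiv.symm.toLinearMap ∘ₗ fockEnergy ∘ₗ fockEquiv.toLinearMap

lemma fockEquiv_chargeOp (v : Upsilon) : fockEquiv (chargeOp v) = fockCharge (fockEquiv v) :=
  fockEquiv.apply_symm_apply _

lemma fockEquiv_energyOp (v : Upsilon) : fockEquiv (energyOp v) = fockEnergy (fockEquiv v) :=
  fockEquiv.apply_symm_apply _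

lemma fockEquiv_extreme (N : ℤ) : fockEquiv (extreme N) = vac N := by
  rw [fockEquiv_apply, toFock_extreme]

lemma isGrading : IsGrading chargeOp energyOp where
  comm v := fockEquiv.injective (by
    rw [map_sub, map_zero, fockEquiv_chargeOp, fockEquiv_energyOp, fockEquiv_energyOp,
      fockEquiv_chargeOp, fock_commute, sub_self])
  c_x i v := fockEquiv.injective (by
    rw [map_sub, fockEquiv_smul, fockEquiv_chargeOp, fockEquiv_chargeOp, fockEquiv_smul,
      fockCharge_x, add_sub_cancel_left])
  c_y i v := fockEquiv.injective (by
    rw [map_sub, fockEquiv_smul, fockEquiv_chargeOp, fockEquiv_chargeOp, fockEquiv_smul,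
      fockCharge_y, add_sub_cancel_left])
  u_x i v := fockEquiv.injective (by
    rw [map_sub, fockEquiv_smul, fockEquiv_energyOp, fockEquiv_energyOp, fockEquiv_smul,
      fockEnergy_x, add_sub_cancel_left, map_smul, fockEquiv_smul])
  u_y i v := fockEquiv.injective (by
    rw [map_sub, fockEquiv_smul, fockEquiv_energyOp, fockEquiv_energyOp, fockEquiv_smul,
      fockEnergy_y, add_sub_cancel_left, map_smul, fockEquiv_smul])
  c_extreme N := fockEquiv.injective (by
    rw [fockEquiv_chargeOp, map_smul, fockEquiv_extreme, fockCharge_vac])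
  u_extreme N := fockEquiv.injective (by
    rw [fockEquiv_energyOp, map_smul, fockEquiv_extreme, fockEnergy_vac])

lemma chargeOp_configBasis (S : Config Row.lower) :
    chargeOp (configBasis S) = (S.charge : ℂ) • configBasis S := fockEquiv.injective (by
  rw [fockEquiv_chargeOp, map_smul, configBasis_apply, fockEquiv_apply, fockCharge_configVector])

lemma energyOp_configBasis (S : Config Row.lower) :
    energyOp (configBasis S) = (S.energy : ℂ) • configBasis S := fockEquiv.injective (by
  rw [fockEquiv_energyOp, map_smul, configBasis_apply, fockEquiv_apply, fockEnergy_configVector])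

/-- A linear operator on `Υ` is determined by its commutators with the generators and by its values
on the extreme vectors. -/
lemma eq_of_commutators {D D' : Module.End ℂ Upsilon} {p q : ℤ → ℂ}
    (hx : ∀ i v, D (x i • v) - x i • D v = p i • x i • v)
    (hy : ∀ i v, D (y i • v) - y i • D v = q i • y i • v)
    (hx' : ∀ i v, D' (x i • v) - x i • D' v = p i • x i • v)
    (hy' : ∀ i v, D' (y i • v) - y i • D' v = q i • y i • v)
    (he : ∀ N, D (extreme N) = D' (extreme N)) : D = D' := by
  -- Agreement of the two operators at a vector passes to its multiples by the algebra, and every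
  -- vector is a multiple of some γ_N.
  have key : ∀ (a : Fermion) (v : Upsilon), D v = D' v → D (a • v) = D' (a • v) := by
    intro a
    induction a using fermion_induction with
    | scalar c => intro v hv; rw [algebraMap_smul, map_smul, map_smul, hv]
    | hx i => intro v hv; rw [eq_add_of_sub_eq (hx i v), eq_add_of_sub_eq (hx' i v), hv]
    | hy i => intro v hv; rw [eq_add_of_sub_eq (hy i v), eq_add_of_sub_eq (hy' i v), hv]
    | mul a b ha hb => intro v hv; rw [mul_smul]; exact ha _ (hb v hv)
    | add a b ha hb => intro v hv; rw [add_smul, map_add, map_add, ha v hv, hb v hv]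
  refine LinearMap.ext fun v => ?_
  obtain ⟨N, a, rfl⟩ := exists_smul_extreme v
  exact key a _ (he N)

lemma isGrading_unique {c u : Module.End ℂ Upsilon} (h : IsGrading c u) :
    c = chargeOp ∧ u = energyOp := by
  have g := isGrading
  refine ⟨eq_of_commutators (p := fun _ => 1) (q := fun _ => 1) ?_ ?_ ?_ ?_
    fun N => (h.c_extreme N).trans (g.c_extreme N).symm,
    eq_of_commutators h.u_x h.u_y g.u_x g.u_y
    fun N => (h.u_extreme N).trans (g.u_extreme N).symm⟩
  · simpa only [one_smul] using h.c_x
  · simpa only [one_smul] using h.c_y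
  · simpa only [one_smul] using g.c_x
  · simpa only [one_smul] using g.c_y

/-! ### Weight spaces -/

lemma repr_diagonal {D : Module.End ℂ Upsilon} {w : Config Row.lower → ℂ}
    (h : ∀ S, D (configBasis S) = w S • configBasis S) (v : Upsilon) (S : Config Row.lower) :
    configBasis.repr (D v) S = w S * configBasis.repr v S := by
  have e : configBasis.coord S ∘ₗ D = w S • configBasis.coord S := configBasis.ext fun T => by
    classical
    rw [LinearMap.comp_apply, h, map_smul, LinearMap.smul_apply, Module.Basis.coord_apply,
      Module.Basis.repr_self, single_apply]
    split_ifs with hTS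
    · rw [hTS]
    · rw [smul_zero, smul_zero]
  exact LinearMap.congr_fun e v

/-- Both operators are diagonal in the basis of configurations, so a weight space is spanned by the
basis vectors of that charge and energy. -/
lemma mem_weightSpace {n m : ℤ} {v : Upsilon} : v ∈ weightSpace chargeOp energyOp n m ↔
    ∀ S, configBasis.repr v S ≠ 0 → S ∈ configsOf Row.lower n m := by
  rw [weightSpace, Submodule.mem_inf, Module.End.mem_eigenspace_iff, Module.End.mem_eigenspace_iff]
  constructor
  · rintro ⟨h1, h2⟩ S hS
    have e1 := congrArg (fun z => configBasis.repr z S) h1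
    have e2 := congrArg (fun z => configBasis.repr z S) h2
    simp only [repr_diagonal chargeOp_configBasis, repr_diagonal energyOp_configBasis, map_smul,
      Finsupp.smul_apply, smul_eq_mul] at e1 e2
    exact ⟨Int.cast_injective (mul_right_cancel₀ hS e1),
      Int.cast_injective (mul_right_cancel₀ hS e2)⟩
  · intro h
    constructor <;> refine configBasis.repr.injective (Finsupp.ext fun S => ?_) <;>
      simp only [repr_diagonal chargeOp_configBasis, repr_diagonal energyOp_configBasis, map_smul,
        Finsupp.smul_apply, smul_eq_mul] <;> by_cases hS : configBasis.repr v S = 0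
    · rw [hS, mul_zero, mul_zero]
    · rw [(h S hS).1]
    · rw [hS, mul_zero, mul_zero]
    · rw [(h S hS).2]

lemma weightSpace_eq_span (n m : ℤ) : weightSpace chargeOp energyOp n m =
    Submodule.span ℂ (configBasis '' configsOf Row.lower n m) := by
  ext v
  rw [mem_weightSpace, Module.Basis.mem_span_image]
  exact ⟨fun h S hS => h S (Finsupp.mem_support_iff.1 hS),
    fun h S hS => h (Finsupp.mem_support_iff.2 hS)⟩

lemma character_eq (n m : ℤ) : character chargeOp energyOp n m = statSum Row.lower n m := by
  have hfin := configsOf_finite Row.lower n m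
  have : Fintype (configsOf Row.lower n m) := hfin.fintype
  have h := finrank_span_eq_card (configBasis.linearIndependent.comp
    (Subtype.val : configsOf Row.lower n m → Config Row.lower) Subtype.val_injective)
  rw [Set.range_comp, Subtype.range_coe] at h
  rw [character, weightSpace_eq_span, h, statSum, Set.ncard_eq_toFinset_card', Set.toFinset_card]

lemma hasCharacter : HasCharacter chargeOp energyOp := by
  refine ⟨DirectSum.isInternal_submodule_of_iSupIndep_of_iSup_eq_top ?_ ?_, fun n m => ?_⟩
  · intro p
    rw [Submodule.disjoint_def]
    intro v hv hv'
    -- Vectors of other weights have zero coordinates at the configurations of weight p, and a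
    -- vector of weight p has no other coordinates.
    have hle : (⨆ (q) (_ : q ≠ p), weightSpace chargeOp energyOp q.1 q.2) ≤
        ⨅ S ∈ configsOf Row.lower p.1 p.2, LinearMap.ker (configBasis.coord S) := by
      refine iSup₂_le fun q hq w hw => ?_
      simp only [Submodule.mem_iInf, LinearMap.mem_ker]
      intro S hS
      by_contra hne
      have := mem_weightSpace.1 hw S hne
      exact hq (Prod.ext (this.1.symm.trans hS.1) (this.2.symm.trans hS.2))
    have h1 := hle hv'
    simp only [Submodule.mem_iInf, LinearMap.mem_ker] at h1
    refine configBasis.repr.injective (Finsupp.ext fun S => ?_)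
    rw [map_zero, Finsupp.zero_apply]
    by_contra hne
    exact hne (h1 S (mem_weightSpace.1 hv S hne))
  · rw [eq_top_iff, ← configBasis.span_eq, Submodule.span_le]
    rintro _ ⟨S, rfl⟩
    refine Submodule.mem_iSup_of_mem (S.charge, S.energy) ?_
    rw [weightSpace_eq_span]
    exact Submodule.subset_span ⟨S, ⟨rfl, rfl⟩, rfl⟩
  · rw [weightSpace_eq_span]
    exact FiniteDimensional.span_of_finite ℂ ((configsOf_finite Row.lower n m).image _)

end SquareLadder

end

theorem proposition3 :
    -- the relations hold on the direct limit
    SquareLadder.RelationsHold ∧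
    -- the operators `c` and `u` exist and are unique
    ∃ c u : Module.End ℂ SquareLadder.Upsilon,
      SquareLadder.IsGrading c u ∧
      (∀ c' u' : Module.End ℂ SquareLadder.Upsilon,
        SquareLadder.IsGrading c' u' → c' = c ∧ u' = u) ∧
      -- both sides of the identity are well-defined formal series
      SquareLadder.HasCharacter c u ∧
      (∀ (r : SquareLadder.Row) (n m : ℤ), (SquareLadder.configsOf r n m).Finite) ∧
      -- the character coincides with the statistical sum, for either type of tail
      (∀ (r : SquareLadder.Row) (n m : ℤ),
        SquareLadder.character c u n m = SquareLadder.statSum r n m) ∧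
      -- the configurations index a basis, whose vectors are the corresponding monomials
      ∃ b : Module.Basis (SquareLadder.Config SquareLadder.Row.lower) ℂ SquareLadder.Upsilon,
        ∀ S : SquareLadder.Config SquareLadder.Row.lower,
          (∃ (N : ℤ) (A B : Finset ℤ), SquareLadder.Represents S N A B) ∧
          (∀ (N : ℤ) (A B : Finset ℤ), SquareLadder.Represents S N A B →
            b S = SquareLadder.monomial A B • SquareLadder.extreme N) ∧
          c (b S) = (S.charge : ℂ) • b S ∧
          u (b S) = (S.energy : ℂ) • b S :=
  ⟨SquareLadder.relationsHold, SquareLadder.chargeOp, SquareLadder.energyOp, SquareLadder.isGrading,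
    fun _ _ h => SquareLadder.isGrading_unique h, SquareLadder.hasCharacter,
    SquareLadder.configsOf_finite,
    fun r n m => (SquareLadder.character_eq n m).trans (SquareLadder.statSum_eq_lower r n m).symm,
    SquareLadder.configBasis, fun S => ⟨SquareLadder.exists_represents S,
      fun _ _ _ h => (SquareLadder.configBasis_apply S).trans (SquareLadder.configVector_eq h),
      SquareLadder.chargeOp_configBasis S, SquareLadder.energyOp_configBasis S⟩⟩
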